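/- Throughout, permutations of $\{1,\dots,m\}$ are written as words $\pi=\pi_1\cdots\pi_m$ and $\mathfrak S_m$ is the set of all of them. Let $r\ge 1$. For $\pi\in\mathfrak S_m$ put $$\mathrm{Excp}_r(\pi)=\{i:\pi_i>i,\ \pi_i\ge r\},\qquad \mathrm{Excl}_r(\pi)=\{\pi_i: i\in \mathrm{Excp}_r(\pi)\},\qquad \mathrm{exc}_r(\pi)=|\{i:\pi_i>i\ge r\}|,$$ $$\mathrm{den}_r(\pi)=\sum_{i\in \mathrm{Excp}_r(\pi)} i+\mathrm{inv}(\mathrm{Exc}_r(\pi))+\mathrm{inv}(\mathrm{Nexc}_r(\pi)),$$ where $\mathrm{Exc}_r(\pi)$ (resp. $\mathrm{Nexc}_r(\pi)$) is the subword of $\pi$ formed by the letters at the places in $\mathrm{Excp}_r(\pi)$ (resp. at the other places), and $\mathrm{inv}$ counts inversions. Elements of $\mathrm{Excp}_r$ and $\mathrm{Excl}_r$ are called $r$-level excedance places and letters. Let $1\le r<n$ and $\pi\in\mathfrak S_{n-1}$. Write $\mathrm{Excl}_r(\pi)=\{e_1<\dots<e_s\}$, $e_{s+1}=n$, $\mathcal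 A(\pi)=\{i<r:\pi_i\ge r\}$, $\mathcal B(\pi)=\{i<r:\pi_i<r\}$. *The $r$-level-den-labeling* labels the $n$ spaces of the index sequence $1\,2\cdots(n-1)$: the space after $n-1$ gets $0$; the space before the index $e_i$ gets $s+1-i$ $(1\le i\le s)$; the spaces before the indices in $\mathcal B(\pi)$ get, from left to right, $s+1,\dots,\mathrm{exc}_r(\pi)+r-1$; the remaining spaces get, from left to right, $\mathrm{exc}_r(\pi)+r,\dots,n-1$. For $r=1$ this is called the den-labeling. For $0\le c\le n-1$ let $x$ be the index such that the space labeled $c$ in the $r$-level-den-labeling is immediately before $x$, with $x=n$ for $c=0$. *The map $\alpha$* (for $x\in\mathcal A(\pi)=\{i_1<\dots<i_k\}$, $x=i_y$). Replace every $e_j$ in $\pi$ by $e_{j+1}$ $(1\le j\le s)$, which gives $\sigma$. Then replace $\sigma_{i_y}$ by $e_1$, replace $\sigma_{i_j}$ by $\sigma_{i_{j-1}}$ for $y<j\le k$, and insert $\sigma_{i_k}$ immediately before $\sigma_r$. The result is $\alpha(\pi,c)$. *The map $\beta$* (for $x\in\mathcal B(\pi)=\{j_1<\dots<j_\ell\}$,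 $x=j_y$). Define $\sigma$ as for $\alpha$. Replace $\sigma_{j_y}$ by $e_1$, replace $\sigma_{j_i}$ by $\sigma_{j_{i-1}}$ for $y<i\le \ell$, and insert $\sigma_{j_\ell}$ immediately before $\sigma_r$, which gives $\sigma'$. Let $e'_1<\dots<e'_k$ be the $r$-level excedance letters of $\sigma'$ at places less than $r$; replace $e'_j$ by $e'_{j-1}$ for $1<j\le k$ and $e'_1$ by $e'_k$. The result is $\beta(\pi,c)$. *Han's insertion map $\phi_n$* (for all $0\le c\le n-1$). Let $f_1<\dots<f_t$ be the letters in $\mathrm{Excl}_1(\pi)$ and $f_{t+1}=n$. Let the space labeled $c$ in the den-labeling be immediately before the index $z$ ($z=n$ if $c=0$), and let $f_y$ be the least of $f_1,\dots,f_{t+1}$ that is $\ge z$. Replace $f_j$ in $\pi$ by $f_{j+1}$ for $y\le j\le t$, then insert $f_y$ so that it becomes the letter at place $z$ (at the end if $z=n$). The result is $\phi_n(\pi,c)$. **Theorem.** Let $1\le r<n$. For every $\pi\in\mathfrak S_{n-1}$ each of $0,1,\dots,n-1$ is the label of exactly one space in the $r$-level-den-labeling, and $$\phi^{\mathrm{den}}_{r,n}(\pi,c)=\begin{cases}\alpha(\pi,c)&\text{if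 } x\in\mathcal A(\pi),\\ \beta(\pi,c)&\text{if } x\in\mathcal B(\pi),\\ \phi_n(\pi,c)&\text{otherwise (i.e. if } c=0 \text{ or } x\ge r)\end{cases}$$ defines a bijection $\phi^{\mathrm{den}}_{r,n}:\mathfrak S_{n-1}\times\{0,1,\dots,n-1\}\to\mathfrak S_n$ such that for all $\pi\in\mathfrak S_{n-1}$ and $0\le c\le n-1$ $$\mathrm{exc}_r(\phi^{\mathrm{den}}_{r,n}(\pi,c))=\begin{cases}\mathrm{exc}_r(\pi)&\text{if }0\le c\le \mathrm{exc}_r(\pi)+r-1,\\ \mathrm{exc}_r(\pi)+1&\text{otherwise,}\end{cases}\qquad \mathrm{den}_r(\phi^{\mathrm{den}}_{r,n}(\pi,c))=\mathrm{den}_r(\pi)+c.$$ -/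

import Mathlib

namespace RDenert

/-! A word `w_1 w_2 … w_m` of positive integers is a function `w : ℕ → ℕ` together with its length
`m`; only the values at `1, …, m` matter. Places and letters are numbered from `1`. -/

/-- The one-line notation `π_1 π_2 … π_m` of a permutation of `m` objects
(`Fin m = {0, …, m - 1}`, so places and letters are shifted by one). -/
def letters {m : ℕ} (π : Equiv.Perm (Fin m)) (i : ℕ) : ℕ :=
  if h : 1 ≤ i ∧ i ≤ m then (π ⟨i - 1, by omega⟩ : ℕ) + 1 else 0

/-- The set of `r`-level excedance places: `w_i > i` and `w_i ≥ r`. -/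
def excPlaces (r m : ℕ) (w : ℕ → ℕ) : Finset ℕ :=
  (Finset.Icc 1 m).filter fun i => i < w i ∧ r ≤ w i

/-- The set of places that are not `r`-level excedance places. -/
def nonexcPlaces (r m : ℕ) (w : ℕ → ℕ) : Finset ℕ :=
  Finset.Icc 1 m \ excPlaces r m w

/-- The set of `r`-level excedance letters. -/
def excLetters (r m : ℕ) (w : ℕ → ℕ) : Finset ℕ :=
  (excPlaces r m w).image w

/-- The number of inversions of the subword of `w` formed by the letters at the places in `P`,
read from left to right. -/
def inv (P : Finset ℕ) (w : ℕ → ℕ) : ℕ :=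
  ((P ×ˢ P).filter fun p => p.1 < p.2 ∧ w p.2 < w p.1).card

/-- The `r`-level excedance number `|{i : w_i > i ≥ r}|`. -/
def exc (r m : ℕ) (w : ℕ → ℕ) : ℕ :=
  ((Finset.Icc 1 m).filter fun i => i < w i ∧ r ≤ i).card

/-- The `r`-level Denert statistic. -/
def den (r m : ℕ) (w : ℕ → ℕ) : ℕ :=
  ∑ i ∈ excPlaces r m w, i + inv (excPlaces r m w) w + inv (nonexcPlaces r m w) w

/-- `𝒜 = {i < r : w_i ≥ r}`. -/
def setA (r m : ℕ) (w : ℕ → ℕ) : Finset ℕ :=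
  (Finset.Icc 1 m).filter fun i => r ≤ w i ∧ i < r

/-- `ℬ = {i < r : w_i < r}`. -/
def setB (r m : ℕ) (w : ℕ → ℕ) : Finset ℕ :=
  (Finset.Icc 1 m).filter fun i => w i < r ∧ i < r

/-- The `r`-level-den-labeling of the `m + 1` spaces of the index sequence `1 2 … m`.
For `1 ≤ x ≤ m`, `label r m w x` is the label of the space immediately before the index `x`,
and `label r m w (m + 1)` is the label of the space after the index `m`.
The three cases for `x ≤ m`: the `i`-th smallest of the `s` excedance letters gets `s + 1 - i`; then
the elements of `ℬ` get, from left to right, `s + 1, s + 2, …`; then the remaining indices get, from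
left to right, `exc + r, exc + r + 1, …`. For `r = 1` this is the den-labeling. -/
def label (r m : ℕ) (w : ℕ → ℕ) (x : ℕ) : ℕ :=
  if x = m + 1 then 0
  else if x ∈ excLetters r m w then ((excLetters r m w).filter fun e => x ≤ e).card
  else if x ∈ setB r m w then
    (excLetters r m w).card + ((setB r m w).filter fun j => j ≤ x).card
  else exc r m w + r - 1 +
    ((Finset.Icc 1 m \ (excLetters r m w ∪ setB r m w)).filter fun j => j ≤ x).card

/-- The space `x ∈ {1, …, m + 1}` that carries the label `c` in the `r`-level-den-labeling. (There
is exactly one such `x` if `0 ≤ c ≤ m`, so that the maximum below is taken over one element.) -/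
def space (r m : ℕ) (w : ℕ → ℕ) (c : ℕ) : ℕ :=
  ((Finset.Icc 1 (m + 1)).filter fun x => label r m w x = c).sup id

/-- The least element that is `≥ a` of `E ∪ {n}`, where all elements of `E` and `a` are `≤ n`.
For `E = {e_1 < ⋯ < e_s}` and `e_{s+1} = n` this is `e_1` if `a = 0`, and `e_{j+1}` if
`a = e_j + 1`. -/
def least (E : Finset ℕ) (n a : ℕ) : ℕ :=
  (insert n (E.filter fun e => a ≤ e)).min' (Finset.insert_nonempty _ _)

/-- Replace every letter `e_j ≥ a` of `w` in `E = {e_1 < ⋯ < e_s}` by `e_{j+1}`,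
where `e_{s+1} = n`. -/
def raise (E : Finset ℕ) (n a : ℕ) (w : ℕ → ℕ) (i : ℕ) : ℕ :=
  if w i ∈ E ∧ a ≤ w i then least E n (w i + 1) else w i

/-- Insert the letter `v` immediately before the letter at the place `x`. -/
def insertBefore (x v : ℕ) (w : ℕ → ℕ) (i : ℕ) : ℕ :=
  if i < x then w i else if i = x then v else w (i - 1)

/-- Han's insertion map `φ_n`, `n = m + 1`: if the space labeled `c` in the den-labeling is `x`, with
insertion letter `e_y` (the least element of `{e_1, …, e_s, n}` that is `≥ x`), replace `e_j` by
`e_{j+1}` for `j ≥ y`, then insert `e_y` before the place `x`. For `c = 0` one has `x = e_y = n`, and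
`n` is appended at the end. -/
def han (m : ℕ) (w : ℕ → ℕ) (c : ℕ) : ℕ → ℕ :=
  let E := excLetters 1 m w
  let x := space 1 m w c
  let v := least E (m + 1) x
  insertBefore x v (raise E (m + 1) v w)

/-- For a set of places `P = {p_1 < ⋯ < p_k} ⊆ {1, …, r - 1}` and `x = p_y`: replace `w_{p_y}` by
`v`, replace `w_{p_j}` by `w_{p_{j-1}}` for `y < j ≤ k`, and insert `w_{p_k}` immediately before
`w_r`. -/
def push (P : Finset ℕ) (r x v : ℕ) (w : ℕ → ℕ) : ℕ → ℕ :=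
  insertBefore r (w (P.sup id)) fun i =>
    if i = x then v
    else if i ∈ P ∧ x < i then w ((P.filter fun p => p < i).sup id)
    else w i

/-- The map `α_{r,n}`, `n = m + 1`. -/
def alpha (r m : ℕ) (w : ℕ → ℕ) (c : ℕ) : ℕ → ℕ :=
  let E := excLetters r m w
  push (setA r m w) r (space r m w c) (least E (m + 1) 0) (raise E (m + 1) 0 w)

/-- For `F = {f_1 < ⋯ < f_k}`, replace every letter `f_j` with `1 < j ≤ k` by `f_{j-1}` and replace
the letter `f_1` by `f_k`. -/
def rotate (F : Finset ℕ) (w : ℕ → ℕ) (i : ℕ) : ℕ :=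
  if w i ∈ F then
    if (F.filter fun f => f < w i).Nonempty then (F.filter fun f => f < w i).sup id else F.sup id
  else w i

/-- The map `β_{r,n}`, `n = m + 1`. -/
def beta (r m : ℕ) (w : ℕ → ℕ) (c : ℕ) : ℕ → ℕ :=
  let E := excLetters r m w
  let w' := push (setB r m w) r (space r m w c) (least E (m + 1) 0) (raise E (m + 1) 0 w)
  rotate (((excPlaces r (m + 1) w').filter fun i => i < r).image w') w'

/-- The map glued from `α`, `β` and Han's insertion map, on one-line notations. -/
def phiDen (r m : ℕ) (w : ℕ → ℕ) (c : ℕ) : ℕ → ℕ :=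
  if space r m w c ∈ setA r m w then alpha r m w c
  else if space r m w c ∈ setB r m w then beta r m w c
  else han m w c

end RDenert

/-! Put `m = n - 1` and let `E` be the set of excedance letters of `w`. All maps are studied as
insertions of `w` at a space `x` (`glue`), with the label `c` recovered from `x` only at the end.
Each insertion has one form: a new letter sits at `x`, and every other place `i` carries the
possibly raised letter of a place `q i` of `w`. Raising moves letters of `E` up along the chain `E ∪
{n}`. This keeps their relative order, and it makes up for the shift of places by one, so that `i`
is an excedance place exactly when `q i` was one. Hence the change of `den` comes only from the
displaced excedance places and the inversions involving the new letter.

That change is the label of `x`, once the label has a closed form. For `x ≥ r` it is the number of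
letters `≥ x` in `E`, plus `x` if `x` is neither in `E` nor equal to `n`; for a fixed point this
uses that as many letters `≥ x` stand left of `x` as letters `< x` stand from `x` on. For `x ∈ 𝒜`
the excedance places gain `r` and the high ones move by one, while the new letter `e_1`, smallest of
all excedance letters, is inverted with the places of `𝒜` left of `x`: in all `exc + r + #{j ∈ 𝒜 : j
< x}`. For `x ∈ ℬ` the place `x` is gained instead; the rotation turns `e_1` into the largest letter
at the low excedance places and keeps the order of the others, so the new inversions are with the
places of `𝒜` right of `x`: in all `x + exc + #{j ∈ 𝒜 : j > x}`. These counts are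
`den_hanInsert_of_fixed`, `den_hanInsert_of_exc`, `den_alphaInsert` and `den_betaInsert`.

For bijectivity, injectivity suffices, since `n! = n · (n - 1)!`. An output of Han's insertion at `x
≥ r` has a tight place (`IsTight`), and the largest one is `x`; outputs of `α` and `β` have none,
and these two differ in whether the letter at place `r` is `≥ r`. Within each kind the output
determines `E`, then `x` and the place map, and then `w` (`glue_inj`). -/

namespace RDenert

/-! ### Words and permutations -/

/-- The word `w` restricted to the places `1, …, m` is a permutation of `1, …, m`. -/
structure IsWord (m : ℕ) (w : ℕ → ℕ) : Prop where
  pos : ∀ {i}, 1 ≤ i → i ≤ m → 1 ≤ w i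
  le : ∀ {i}, 1 ≤ i → i ≤ m → w i ≤ m
  inj : ∀ {i j}, 1 ≤ i → i ≤ m → 1 ≤ j → j ≤ m → w i = w j → i = j

/-- An injective map to a finite set that is not larger is surjective. -/
theorem exists_preimage {S T : Finset ℕ} {f : ℕ → ℕ} (hf : ∀ i ∈ S, f i ∈ T)
    (hinj : Set.InjOn f S) (hcard : T.card ≤ S.card) {l : ℕ} (hl : l ∈ T) :
    ∃ i ∈ S, f i = l := by
  have := Finset.eq_of_subset_of_card_le (s := S.image f) (t := T)
    (by intro y hy; obtain ⟨i, hi, rfl⟩ := Finset.mem_image.1 hy; exact hf i hi)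
    (by rw [Finset.card_image_of_injOn hinj]; exact hcard)
  rw [← this] at hl
  simpa using hl

theorem IsWord.surj {m : ℕ} {w : ℕ → ℕ} (h : IsWord m w) {l : ℕ} (h1 : 1 ≤ l) (hl : l ≤ m) :
    ∃ i, 1 ≤ i ∧ i ≤ m ∧ w i = l := by
  obtain ⟨i, hi, e⟩ := exists_preimage (S := Finset.Icc 1 m) (T := Finset.Icc 1 m) (f := w)
    (fun i hi => by rw [Finset.mem_Icc] at *; exact ⟨h.pos hi.1 hi.2, h.le hi.1 hi.2⟩)
    (fun i hi j hj => by
      simp only [Finset.coe_Icc, Set.mem_Icc] at hi hj; exact h.inj hi.1 hi.2 hj.1 hj.2)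
    le_rfl (Finset.mem_Icc.2 ⟨h1, hl⟩)
  rw [Finset.mem_Icc] at hi
  exact ⟨i, hi.1, hi.2, e⟩

theorem letters_apply {m : ℕ} (π : Equiv.Perm (Fin m)) (k : Fin m) :
    letters π (k + 1) = (π k : ℕ) + 1 := by
  have : 1 ≤ (k : ℕ) + 1 ∧ (k : ℕ) + 1 ≤ m := ⟨by omega, k.2⟩
  simp [letters]

theorem isWord_letters {m : ℕ} (π : Equiv.Perm (Fin m)) : IsWord m (letters π) := by
  have key : ∀ {i}, 1 ≤ i → i ≤ m → ∃ k : Fin m, i = k + 1 := fun {i} h1 h2 =>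
    ⟨⟨i - 1, by omega⟩, by simp; omega⟩
  refine ⟨fun h1 h2 => ?_, fun h1 h2 => ?_, fun h1 h2 h3 h4 h => ?_⟩
  · obtain ⟨k, rfl⟩ := key h1 h2
    rw [letters_apply]; omega
  · obtain ⟨k, rfl⟩ := key h1 h2
    rw [letters_apply]; exact (π k).2
  · obtain ⟨k, rfl⟩ := key h1 h2
    obtain ⟨l, rfl⟩ := key h3 h4
    rw [letters_apply, letters_apply] at h
    have : π k = π l := Fin.ext (by omega)
    rw [π.injective this]

theorem letters_injective {m : ℕ} {π ρ : Equiv.Perm (Fin m)}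
    (h : ∀ i, 1 ≤ i → i ≤ m → letters π i = letters ρ i) : π = ρ := by
  ext k
  have := h (k + 1) (by omega) k.2
  rw [letters_apply, letters_apply] at this
  omega

/-- Brings a word built by an insertion back into the symmetric group. -/
theorem IsWord.exists_perm {m : ℕ} {w : ℕ → ℕ} (h : IsWord m w) :
    ∃ π : Equiv.Perm (Fin m), ∀ i, 1 ≤ i → i ≤ m → letters π i = w i := by
  let f : Fin m → Fin m := fun k => ⟨w (k + 1) - 1, by
    have := h.pos (i := k + 1) (by omega) k.2
    have := h.le (i := k + 1) (by omega) k.2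
    omega⟩
  have hf : Function.Injective f := by
    intro k l hkl
    have e : w (k + 1) - 1 = w (l + 1) - 1 := congrArg Fin.val hkl
    have := h.pos (i := k + 1) (by omega) k.2
    have := h.pos (i := l + 1) (by omega) l.2
    have := h.inj (i := k + 1) (j := l + 1) (by omega) k.2 (by omega) l.2 (by omega)
    exact Fin.ext (by omega)
  refine ⟨Equiv.ofBijective f (Finite.injective_iff_bijective.1 hf), fun i h1 h2 => ?_⟩
  obtain ⟨k, rfl⟩ : ∃ k : Fin m, i = k + 1 := ⟨⟨i - 1, by omega⟩, by simp; omega⟩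
  rw [letters_apply]
  have := h.pos h1 h2
  simp only [Equiv.ofBijective_apply, f]
  omega

/-! ### Excedance places and letters -/

/-- The excedance places that are at least `r`. -/
def highPlaces (r m : ℕ) (w : ℕ → ℕ) : Finset ℕ :=
  (Finset.Icc 1 m).filter fun i => i < w i ∧ r ≤ i

theorem exc_eq_card (r m : ℕ) (w : ℕ → ℕ) : exc r m w = (highPlaces r m w).card := rfl

section Basic
variable {r m : ℕ} {w : ℕ → ℕ}

theorem mem_excPlaces {i : ℕ} :
    i ∈ excPlaces r m w ↔ (1 ≤ i ∧ i ≤ m) ∧ i < w i ∧ r ≤ w i := by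
  simp [excPlaces]

theorem excPlaces_subset : excPlaces r m w ⊆ Finset.Icc 1 m := Finset.filter_subset _ _

theorem nonexcPlaces_subset : nonexcPlaces r m w ⊆ Finset.Icc 1 m := Finset.sdiff_subset

theorem mem_nonexcPlaces {i : ℕ} :
    i ∈ nonexcPlaces r m w ↔ (1 ≤ i ∧ i ≤ m) ∧ i ∉ excPlaces r m w := by
  simp [nonexcPlaces]

theorem mem_setA {i : ℕ} : i ∈ setA r m w ↔ (1 ≤ i ∧ i ≤ m) ∧ r ≤ w i ∧ i < r := by
  simp [setA]

theorem mem_setB {i : ℕ} : i ∈ setB r m w ↔ (1 ≤ i ∧ i ≤ m) ∧ w i < r ∧ i < r := by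
  simp [setB]

theorem mem_highPlaces {i : ℕ} : i ∈ highPlaces r m w ↔ (1 ≤ i ∧ i ≤ m) ∧ i < w i ∧ r ≤ i := by
  simp [highPlaces]

theorem excPlaces_eq_union : excPlaces r m w = setA r m w ∪ highPlaces r m w := by
  ext i
  simp only [Finset.mem_union, mem_excPlaces, mem_setA, mem_highPlaces]
  omega

theorem disjoint_setA_highPlaces : Disjoint (setA r m w) (highPlaces r m w) := by
  rw [Finset.disjoint_left]
  intro i
  simp only [mem_setA, mem_highPlaces]
  omega

theorem IsWord.mem_excLetters (hw : IsWord m w) {i : ℕ} (h1 : 1 ≤ i) (h2 : i ≤ m) :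
    w i ∈ excLetters r m w ↔ i ∈ excPlaces r m w := by
  constructor
  · intro h
    obtain ⟨j, hj, e⟩ := Finset.mem_image.1 h
    have hj' := (mem_excPlaces.1 hj).1
    rwa [← hw.inj hj'.1 hj'.2 h1 h2 e]
  · exact fun h => Finset.mem_image_of_mem _ h

theorem IsWord.excLetters_bounds (hw : IsWord m w) {e : ℕ} (he : e ∈ excLetters r m w) :
    r ≤ e ∧ 1 < e ∧ e ≤ m := by
  obtain ⟨j, hj, rfl⟩ := Finset.mem_image.1 he
  have hj' := mem_excPlaces.1 hj
  have := hw.le hj'.1.1 hj'.1.2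
  omega

theorem IsWord.injOn (hw : IsWord m w) {S : Finset ℕ} (hS : S ⊆ Finset.Icc 1 m) :
    Set.InjOn w S := by
  intro i hi j hj h
  have hi' := Finset.mem_Icc.1 (hS hi)
  have hj' := Finset.mem_Icc.1 (hS hj)
  exact hw.inj hi'.1 hi'.2 hj'.1 hj'.2 h

theorem IsWord.card_excLetters (hw : IsWord m w) :
    (excLetters r m w).card = exc r m w + (setA r m w).card := by
  rw [excLetters, Finset.card_image_of_injOn (hw.injOn excPlaces_subset),
    excPlaces_eq_union, Finset.card_union_of_disjoint disjoint_setA_highPlaces, exc_eq_card,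
    add_comm]

theorem card_filter_setA_add_setB {x : ℕ} (hx : x < r) (hr : r ≤ m + 1) :
    ((setA r m w).filter fun j => j ≤ x).card + ((setB r m w).filter fun j => j ≤ x).card = x := by
  rw [← Finset.card_union_of_disjoint]
  · have : ((setA r m w).filter fun j => j ≤ x) ∪ ((setB r m w).filter fun j => j ≤ x)
        = Finset.Icc 1 x := by
      ext i
      simp only [Finset.mem_union, Finset.mem_filter, mem_setA, mem_setB, Finset.mem_Icc]
      omega
    rw [this]; simp
  · rw [Finset.disjoint_left]
    intro i
    simp only [Finset.mem_filter, mem_setA, mem_setB]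
    omega

theorem card_setA_add_setB (h1 : 1 ≤ r) (hr : r ≤ m + 1) :
    (setA r m w).card + (setB r m w).card = r - 1 := by
  rw [← card_filter_setA_add_setB (r := r) (m := m) (w := w) (x := r - 1) (by omega) hr]
  congr 2 <;> rw [Finset.filter_true_of_mem]
  · intro i; simp only [mem_setA]; omega
  · intro i; simp only [mem_setB]; omega

/-! ### The labeling -/

theorem label_last : label r m w (m + 1) = 0 := by simp [label]

theorem IsWord.label_excLetters (hw : IsWord m w) {x : ℕ} (hx : x ∈ excLetters r m w) :
    label r m w x = ((excLetters r m w).filter fun e => x ≤ e).card := by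
  have := hw.excLetters_bounds hx
  rw [label, if_neg (by omega), if_pos hx]

theorem IsWord.notMem_excLetters_of_lt (hw : IsWord m w) {x : ℕ} (hx : x < r) :
    x ∉ excLetters r m w := fun h => by
  have := hw.excLetters_bounds h
  omega

theorem IsWord.label_setB (hw : IsWord m w) {x : ℕ} (hx : x ∈ setB r m w) :
    label r m w x = (excLetters r m w).card + ((setB r m w).filter fun j => j ≤ x).card := by
  have h := mem_setB.1 hx
  rw [label, if_neg (by omega), if_neg (hw.notMem_excLetters_of_lt h.2.2), if_pos hx]

theorem label_of_notMem {x : ℕ} (hx : x ≤ m) (hE : x ∉ excLetters r m w) (hB : x ∉ setB r m w) :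
    label r m w x = exc r m w + r - 1 +
      ((Finset.Icc 1 m \ (excLetters r m w ∪ setB r m w)).filter fun j => j ≤ x).card := by
  rw [label, if_neg (by omega), if_neg hE, if_neg hB]

theorem card_filter_le_add_lt (S : Finset ℕ) (x : ℕ) :
    (S.filter fun j => j ≤ x).card + (S.filter fun j => x < j).card = S.card := by
  rw [← Finset.card_filter_add_card_filter_not (s := S) (fun j => j ≤ x)]
  simp only [not_le]

/-- The indices up to `x < r` are shared between `𝒜` and `ℬ`, and `|E| = exc + |𝒜|`. In this form
the label is visibly the increase of `den` under `β`. -/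
theorem IsWord.label_setB_eq (hw : IsWord m w) (hr : r ≤ m + 1) {x : ℕ}
    (hx : x ∈ setB r m w) :
    label r m w x = x + exc r m w + ((setA r m w).filter fun j => x < j).card := by
  have h1 := card_filter_setA_add_setB (w := w) (mem_setB.1 hx).2.2 hr
  have h2 := card_filter_le_add_lt (setA r m w) x
  rw [hw.label_setB hx, hw.card_excLetters]
  omega

theorem card_filter_le_of_mem {S : Finset ℕ} {x : ℕ} (hx : x ∈ S) :
    (S.filter fun j => j ≤ x).card = (S.filter fun j => j < x).card + 1 := by
  rw [← Finset.card_insert_of_notMem (s := S.filter fun j => j < x) (a := x) (by simp)]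
  congr 1
  ext j
  simp only [Finset.mem_filter, Finset.mem_insert]
  constructor
  · rintro ⟨h1, h2⟩
    rcases h2.eq_or_lt with h | h
    · exact Or.inl h
    · exact Or.inr ⟨h1, h⟩
  · rintro (rfl | ⟨h1, h2⟩)
    · exact ⟨hx, le_rfl⟩
    · exact ⟨h1, h2.le⟩

/-- Excedance letters are at least `r`, so below `r` the indices labeled last are exactly those of
`𝒜`. -/
theorem IsWord.label_setA_eq (hw : IsWord m w) (h1 : 1 ≤ r) {x : ℕ}
    (hx : x ∈ setA r m w) :
    label r m w x = exc r m w + r + ((setA r m w).filter fun j => j < x).card := by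
  have h := mem_setA.1 hx
  rw [label_of_notMem h.1.2 (hw.notMem_excLetters_of_lt h.2.2)
    (fun hB => by have := mem_setB.1 hB; omega)]
  have : ((Finset.Icc 1 m \ (excLetters r m w ∪ setB r m w)).filter fun j => j ≤ x)
      = (setA r m w).filter fun j => j ≤ x := by
    ext j
    simp only [Finset.mem_filter, Finset.mem_sdiff, Finset.mem_union, Finset.mem_Icc, mem_setA,
      mem_setB]
    have := hw.notMem_excLetters_of_lt (r := r) (x := j)
    constructor
    · rintro ⟨⟨h1, h2⟩, h3⟩
      push Not at h2
      exact ⟨⟨h1, by have := h2.2 h1; omega, by omega⟩, h3⟩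
    · rintro ⟨⟨h1, h2⟩, h3⟩
      exact ⟨⟨h1, by have := this (by omega); push Not; exact ⟨this, by omega⟩⟩, h3⟩
  rw [this, card_filter_le_of_mem hx]
  omega

theorem IsWord.card_excLetters_add (hw : IsWord m w) (h1 : 1 ≤ r) (hr : r ≤ m + 1) :
    (excLetters r m w).card + (setB r m w).card = exc r m w + r - 1 := by
  have := card_setA_add_setB (w := w) h1 hr
  have := hw.card_excLetters (r := r)
  omega

/-- Up to `x` there are `x - #{e ∈ E : e ≤ x} - |ℬ|` remaining indices, and the offset `exc + r - 1`
is `|E| + |ℬ|`; what survives is `x` plus the number of letters of `E` beyond `x`. -/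
theorem IsWord.label_of_ge (hw : IsWord m w) (h1 : 1 ≤ r) {x : ℕ}
    (hx : r ≤ x) (hxm : x ≤ m) (hE : x ∉ excLetters r m w) :
    label r m w x = x + ((excLetters r m w).filter fun e => x ≤ e).card := by
  rw [label_of_notMem hxm hE (fun hB => by have := mem_setB.1 hB; omega)]
  have key : ((Finset.Icc 1 m \ (excLetters r m w ∪ setB r m w)).filter fun j => j ≤ x)
      = Finset.Icc 1 x \ (((excLetters r m w).filter fun j => j ≤ x) ∪ setB r m w) := by
    ext j
    simp only [Finset.mem_filter, Finset.mem_sdiff, Finset.mem_union, Finset.mem_Icc]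
    constructor
    · rintro ⟨⟨a, b⟩, c⟩
      exact ⟨⟨a.1, c⟩, fun h => b (h.imp And.left id)⟩
    · rintro ⟨⟨a, c⟩, b⟩
      exact ⟨⟨⟨a, c.trans hxm⟩, fun h => b (h.imp (fun h => ⟨h, c⟩) id)⟩, c⟩
  have hd : Disjoint ((excLetters r m w).filter fun j => j ≤ x) (setB r m w) := by
    rw [Finset.disjoint_left]
    intro j hj hB
    have := hw.excLetters_bounds (Finset.mem_filter.1 hj).1
    have := mem_setB.1 hB
    omega
  have hsub : ((excLetters r m w).filter fun j => j ≤ x) ∪ setB r m w ⊆ Finset.Icc 1 x := by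
    intro j hj
    rw [Finset.mem_Icc]
    rcases Finset.mem_union.1 hj with hj | hj
    · have := hw.excLetters_bounds (Finset.mem_filter.1 hj).1
      have := (Finset.mem_filter.1 hj).2
      omega
    · have := mem_setB.1 hj
      omega
  have hc := Finset.card_le_card hsub
  rw [key, Finset.card_sdiff_of_subset hsub, Finset.card_union_of_disjoint hd]
  rw [Finset.card_union_of_disjoint hd] at hc
  have h2 := card_filter_le_add_lt (excLetters r m w) x
  have h3 : ((excLetters r m w).filter fun e => x ≤ e) = (excLetters r m w).filter fun e => x < e := by
    apply Finset.filter_congr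
    intro e he
    have : x ≠ e := fun h => hE (h ▸ he)
    omega
  have h4 := hw.card_excLetters_add h1 (by omega)
  simp only [Nat.card_Icc] at hc ⊢
  rw [h3]
  omega

theorem card_filter_le_inj {S : Finset ℕ} {x y : ℕ} (hx : x ∈ S) (hy : y ∈ S)
    (h : (S.filter fun j => j ≤ x).card = (S.filter fun j => j ≤ y).card) : x = y := by
  by_contra hne
  wlog hlt : x < y generalizing x y
  · exact this hy hx h.symm (Ne.symm hne) (by omega)
  refine h.not_lt (Finset.card_lt_card ?_)
  rw [Finset.ssubset_iff_of_subset]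
  · exact ⟨y, by simp [hy], by simp [hlt]⟩
  · intro j
    simp only [Finset.mem_filter]
    exact fun ⟨a, b⟩ => ⟨a, b.trans hlt.le⟩

theorem card_filter_ge_inj {S : Finset ℕ} {x y : ℕ} (hx : x ∈ S) (hy : y ∈ S)
    (h : (S.filter fun j => x ≤ j).card = (S.filter fun j => y ≤ j).card) : x = y := by
  by_contra hne
  wlog hlt : y < x generalizing x y
  · exact this hy hx h.symm (Ne.symm hne) (by omega)
  refine h.not_lt (Finset.card_lt_card ?_)
  rw [Finset.ssubset_iff_of_subset]
  · exact ⟨y, by simp [hy], by simp [hlt]⟩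
  · intro j
    simp only [Finset.mem_filter]
    exact fun ⟨a, b⟩ => ⟨a, hlt.le.trans b⟩

theorem one_le_card_filter {S : Finset ℕ} {p : ℕ → Prop} [DecidablePred p] {x : ℕ} (hx : x ∈ S)
    (hp : p x) : 1 ≤ (S.filter p).card :=
  Finset.card_pos.2 ⟨x, Finset.mem_filter.2 ⟨hx, hp⟩⟩

/-- The four classes of spaces, with the ranges of their labels. -/
theorem IsWord.label_cases (hw : IsWord m w) (h1 : 1 ≤ r) (hr : r ≤ m + 1) {x : ℕ}
    (hx1 : 1 ≤ x) (hx : x ≤ m + 1) :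
    (x = m + 1 ∧ label r m w x = 0) ∨
    (x ∈ excLetters r m w ∧ 1 ≤ label r m w x ∧ label r m w x ≤ (excLetters r m w).card) ∨
    (x ∈ setB r m w ∧ (excLetters r m w).card + 1 ≤ label r m w x ∧
      label r m w x ≤ exc r m w + r - 1) ∨
    (x ∈ Finset.Icc 1 m \ (excLetters r m w ∪ setB r m w) ∧
      exc r m w + r ≤ label r m w x ∧ label r m w x ≤ m) := by
  by_cases hl : x = m + 1
  · exact Or.inl ⟨hl, hl ▸ label_last⟩
  right
  by_cases hE : x ∈ excLetters r m w
  · left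
    rw [hw.label_excLetters hE]
    exact ⟨hE, one_le_card_filter hE le_rfl, Finset.card_filter_le _ _⟩
  right
  have h4 := hw.card_excLetters_add h1 hr
  by_cases hB : x ∈ setB r m w
  · left
    rw [hw.label_setB hB]
    have := one_le_card_filter (p := fun j => j ≤ x) hB le_rfl
    have := Finset.card_filter_le (setB r m w) (fun j => j ≤ x)
    exact ⟨hB, by omega, by omega⟩
  right
  have hmem : x ∈ Finset.Icc 1 m \ (excLetters r m w ∪ setB r m w) := by
    simp only [Finset.mem_sdiff, Finset.mem_union, Finset.mem_Icc]
    exact ⟨⟨hx1, by omega⟩, by tauto⟩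
  rw [label_of_notMem (by omega) hE hB]
  refine ⟨hmem, ?_, ?_⟩
  · have := one_le_card_filter (p := fun j => j ≤ x) hmem le_rfl
    omega
  · have h5 := Finset.card_filter_le (Finset.Icc 1 m \ (excLetters r m w ∪ setB r m w))
      (fun j => j ≤ x)
    have hd : Disjoint (excLetters r m w) (setB r m w) := by
      rw [Finset.disjoint_left]
      intro j hj hB
      have := hw.excLetters_bounds hj
      have := mem_setB.1 hB
      omega
    have hsub : excLetters r m w ∪ setB r m w ⊆ Finset.Icc 1 m := by
      intro j hj
      rw [Finset.mem_Icc]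
      rcases Finset.mem_union.1 hj with hj | hj
      · have := hw.excLetters_bounds hj
        omega
      · exact (mem_setB.1 hj).1
    have hc := Finset.card_le_card hsub
    rw [Finset.card_sdiff_of_subset hsub] at h5
    rw [Finset.card_union_of_disjoint hd, Nat.card_Icc] at *
    omega

theorem IsWord.label_le (hw : IsWord m w) (h1 : 1 ≤ r) (hr : r ≤ m + 1) {x : ℕ}
    (hx1 : 1 ≤ x) (hx : x ≤ m + 1) : label r m w x ≤ m := by
  have hE : excLetters r m w ∪ setB r m w ⊆ Finset.Icc 1 m := by
    intro j hj
    rw [Finset.mem_Icc]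
    rcases Finset.mem_union.1 hj with hj | hj
    · have := hw.excLetters_bounds hj
      omega
    · exact (mem_setB.1 hj).1
  have hd : Disjoint (excLetters r m w) (setB r m w) := by
    rw [Finset.disjoint_left]
    intro j hj hB
    have := hw.excLetters_bounds hj
    have := mem_setB.1 hB
    omega
  have hc := Finset.card_le_card hE
  rw [Finset.card_union_of_disjoint hd, Nat.card_Icc] at hc
  have h4 := hw.card_excLetters_add h1 hr
  rcases hw.label_cases h1 hr hx1 hx with h | h | h | h <;> omega

/-- The four classes of spaces have disjoint ranges of labels, and inside a class the label is a
strictly monotone rank. -/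
theorem IsWord.label_inj (hw : IsWord m w) (h1 : 1 ≤ r) (hr : r ≤ m + 1) {x y : ℕ}
    (hx1 : 1 ≤ x) (hx : x ≤ m + 1) (hy1 : 1 ≤ y) (hy : y ≤ m + 1)
    (h : label r m w x = label r m w y) : x = y := by
  have h4 := hw.card_excLetters_add h1 hr
  rcases hw.label_cases h1 hr hx1 hx with a | ⟨a, a'⟩ | ⟨a, a'⟩ | ⟨a, a'⟩ <;>
  rcases hw.label_cases h1 hr hy1 hy with b | ⟨b, b'⟩ | ⟨b, b'⟩ | ⟨b, b'⟩ <;> try omega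
  · rw [hw.label_excLetters a, hw.label_excLetters b] at h
    exact card_filter_ge_inj a b h
  · rw [hw.label_setB a, hw.label_setB b] at h
    exact card_filter_le_inj a b (by omega)
  · have a2 := a
    have b2 := b
    simp only [Finset.mem_sdiff, Finset.mem_union, Finset.mem_Icc, not_or] at a2 b2
    rw [label_of_notMem a2.1.2 a2.2.1 a2.2.2, label_of_notMem b2.1.2 b2.2.1 b2.2.2] at h
    exact card_filter_le_inj a b (by omega)

theorem IsWord.existsUnique_label (hw : IsWord m w) (h1 : 1 ≤ r) (hr : r ≤ m + 1) {c : ℕ}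
    (hc : c ≤ m) : ∃! x, x ∈ Finset.Icc 1 (m + 1) ∧ label r m w x = c := by
  -- There are `m + 1` spaces and `m + 1` possible labels, so injectivity gives existence.
  obtain ⟨x, hx, e⟩ := exists_preimage (S := Finset.Icc 1 (m + 1)) (T := Finset.range (m + 1))
    (f := label r m w)
    (fun i hi => by
      rw [Finset.mem_Icc] at hi
      rw [Finset.mem_range]
      have := hw.label_le h1 hr hi.1 hi.2
      omega)
    (fun i hi j hj => by
      simp only [Finset.coe_Icc, Set.mem_Icc] at hi hj
      exact hw.label_inj h1 hr hi.1 hi.2 hj.1 hj.2)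
    (by simp) (l := c) (by simp; omega)
  refine ⟨x, ⟨hx, e⟩, fun y ⟨hy, e'⟩ => ?_⟩
  rw [Finset.mem_Icc] at hx hy
  exact hw.label_inj h1 hr hy.1 hy.2 hx.1 hx.2 (e'.trans e.symm)

theorem IsWord.space_label (hw : IsWord m w) (h1 : 1 ≤ r) (hr : r ≤ m + 1) {x : ℕ}
    (hx1 : 1 ≤ x) (hx : x ≤ m + 1) : space r m w (label r m w x) = x := by
  have : ((Finset.Icc 1 (m + 1)).filter fun y => label r m w y = label r m w x) = {x} := by
    ext y
    simp only [Finset.mem_filter, Finset.mem_Icc, Finset.mem_singleton]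
    constructor
    · rintro ⟨hy, e⟩
      exact hw.label_inj h1 hr hy.1 hy.2 hx1 hx e
    · rintro rfl
      exact ⟨⟨hx1, hx⟩, rfl⟩
  rw [space, this]
  simp

theorem IsWord.exists_label_eq (hw : IsWord m w) (h1 : 1 ≤ r) (hr : r ≤ m + 1) {c : ℕ}
    (hc : c ≤ m) : ∃ x, 1 ≤ x ∧ x ≤ m + 1 ∧ label r m w x = c ∧ space r m w c = x := by
  obtain ⟨x, ⟨hx, rfl⟩, -⟩ := hw.existsUnique_label h1 hr hc
  rw [Finset.mem_Icc] at hx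
  exact ⟨x, hx.1, hx.2, rfl, hw.space_label h1 hr hx.1 hx.2⟩

theorem excLetters_eq_filter (h1 : 1 ≤ r) :
    excLetters r m w = (excLetters 1 m w).filter fun e => r ≤ e := by
  ext e
  simp only [excLetters, Finset.mem_image, Finset.mem_filter, mem_excPlaces]
  constructor
  · rintro ⟨i, h, rfl⟩
    exact ⟨⟨i, by omega, rfl⟩, h.2.2⟩
  · rintro ⟨⟨i, h, rfl⟩, h'⟩
    exact ⟨i, by omega, rfl⟩

/-- Right of `r` both labels depend only on the excedance letters `≥ x`, for which the level plays
no role. This is why Han's map, defined by the den-labeling, can be glued to `α` and `β` under one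
labeling. -/
theorem IsWord.label_one (hw : IsWord m w) (h1 : 1 ≤ r) {x : ℕ}
    (hx : r ≤ x) (hxm : x ≤ m + 1) : label 1 m w x = label r m w x := by
  have hf : ((excLetters 1 m w).filter fun e => x ≤ e) =
      ((excLetters r m w).filter fun e => x ≤ e) := by
    rw [excLetters_eq_filter h1, Finset.filter_filter]
    apply Finset.filter_congr
    intro e _
    omega
  rcases hxm.eq_or_lt with rfl | hlt
  · rw [label_last, label_last]
  by_cases hE : x ∈ excLetters r m w
  · have hE1 : x ∈ excLetters 1 m w := by
      rw [excLetters_eq_filter h1] at hE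
      exact (Finset.mem_filter.1 hE).1
    rw [hw.label_excLetters hE, hw.label_excLetters hE1, hf]
  · have hE1 : x ∉ excLetters 1 m w := fun h => hE (by
      rw [excLetters_eq_filter h1]
      exact Finset.mem_filter.2 ⟨h, hx⟩)
    rw [hw.label_of_ge h1 hx (by omega) hE, hw.label_of_ge le_rfl (by omega) (by omega) hE1, hf]

end Basic

/-! ### Predecessors in a finite set -/

/-- The largest element of `S` below `i`. -/
def pred (S : Finset ℕ) (i : ℕ) : ℕ := (S.filter fun j => j < i).sup id

theorem le_pred {S : Finset ℕ} {i j : ℕ} (hj : j ∈ S) (h : j < i) : j ≤ pred S i :=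
  Finset.le_sup (f := id) (Finset.mem_filter.2 ⟨hj, h⟩)

theorem pred_mem {S : Finset ℕ} {i j : ℕ} (hj : j ∈ S) (h : j < i) :
    pred S i ∈ S ∧ pred S i < i := by
  obtain ⟨k, hk, e⟩ := Finset.exists_mem_eq_sup (S.filter fun j => j < i)
    ⟨j, Finset.mem_filter.2 ⟨hj, h⟩⟩ id
  rw [pred, e]
  exact Finset.mem_filter.1 hk

theorem pred_lt_pred {S : Finset ℕ} {i j k : ℕ} (hk : k ∈ S) (hki : k < i) (hi : i ∈ S)
    (hij : i < j) : pred S i < pred S j :=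
  (pred_mem hk hki).2.trans_le (le_pred hi hij)

theorem pred_eq_sup {S : Finset ℕ} {i : ℕ} (h : ∀ j ∈ S, j < i) : pred S i = S.sup id := by
  rw [pred, Finset.filter_true_of_mem h]

/-! ### Raising letters -/

section Up
variable {E : Finset ℕ} {m a : ℕ}

/-- The effect on letters of `raise`. -/
def up (E : Finset ℕ) (n a l : ℕ) : ℕ :=
  if l ∈ E ∧ a ≤ l then least E n (l + 1) else l

theorem raise_eq (E : Finset ℕ) (n a : ℕ) (w : ℕ → ℕ) (i : ℕ) :
    raise E n a w i = up E n a (w i) := rfl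

theorem least_mem (E : Finset ℕ) (n a : ℕ) :
    least E n a = n ∨ (least E n a ∈ E ∧ a ≤ least E n a) := by
  have := Finset.min'_mem (insert n (E.filter fun e => a ≤ e)) (Finset.insert_nonempty _ _)
  rw [Finset.mem_insert, Finset.mem_filter] at this
  exact this

theorem le_least {n : ℕ} (h : a ≤ n) : a ≤ least E n a := by
  rcases least_mem E n a with h' | h'
  · omega
  · exact h'.2

theorem least_le {n e : ℕ} (he : e ∈ E) (h : a ≤ e) : least E n a ≤ e :=
  Finset.min'_le _ _ (Finset.mem_insert_of_mem (Finset.mem_filter.2 ⟨he, h⟩))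

theorem least_le_right {n : ℕ} : least E n a ≤ n :=
  Finset.min'_le _ _ (Finset.mem_insert_self _ _)

theorem least_mem_insert {n : ℕ} : least E n a ∈ insert n E := by
  rw [Finset.mem_insert]
  exact (least_mem E n a).imp id And.left

theorem up_of_not {n l : ℕ} (h : ¬ (l ∈ E ∧ a ≤ l)) : up E n a l = l := if_neg h

theorem up_of {n l : ℕ} (h1 : l ∈ E) (h2 : a ≤ l) : up E n a l = least E n (l + 1) :=
  if_pos ⟨h1, h2⟩

theorem lt_up {l : ℕ} (h1 : l ∈ E) (h2 : a ≤ l) (h3 : l ≤ m) : l < up E (m + 1) a l := by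
  rw [up_of h1 h2]
  exact le_least (by omega)

theorem le_up {l : ℕ} (h3 : l ≤ m) : l ≤ up E (m + 1) a l := by
  by_cases h : l ∈ E ∧ a ≤ l
  · exact (lt_up h.1 h.2 h3).le
  · rw [up_of_not h]

theorem up_le {l : ℕ} (h3 : l ≤ m) : up E (m + 1) a l ≤ m + 1 := by
  by_cases h : l ∈ E ∧ a ≤ l
  · rw [up_of h.1 h.2]; exact least_le_right
  · rw [up_of_not h]; omega

theorem up_mem_insert {n l : ℕ} (h1 : l ∈ E) : up E n a l ∈ insert n E := by
  by_cases h : l ∈ E ∧ a ≤ l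
  · rw [up_of h.1 h.2]; exact least_mem_insert
  · rw [up_of_not h]; exact Finset.mem_insert_of_mem h1

/-- If `k` is raised, it reaches at most the next element of the chain, hence at most `l`, and `l`
itself is then raised strictly. So raising never changes the relative order of excedance letters. -/
theorem up_lt_up {k l : ℕ} (hk : k ∈ E) (hl : l ∈ E) (hkl : k < l) (hlm : l ≤ m) :
    up E (m + 1) a k < up E (m + 1) a l := by
  by_cases h : a ≤ k
  · rw [up_of hk h]
    exact (least_le hl hkl).trans_lt (lt_up hl (h.trans hkl.le) hlm)
  · rw [up_of_not (fun h' => h h'.2)]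
    exact hkl.trans_le (le_up hlm)

theorem up_lt_up_iff {k l : ℕ} (hk : k ∈ E) (hl : l ∈ E) (hkm : k ≤ m) (hlm : l ≤ m) :
    up E (m + 1) a k < up E (m + 1) a l ↔ k < l := by
  constructor
  · intro h
    by_contra hc
    rcases (not_lt.1 hc).eq_or_lt with rfl | hlt
    · exact lt_irrefl _ h
    · exact lt_asymm h (up_lt_up hl hk hlt hkm)
  · exact fun h => up_lt_up hk hl h hlm

theorem up_inj {k l : ℕ} (hkm : k ≤ m) (hlm : l ≤ m)
    (h : up E (m + 1) a k = up E (m + 1) a l) : k = l := by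
  -- Letters of `E` stay in `E ∪ {m + 1}`, while a letter `≤ m` outside `E` is fixed, so the two
  -- kinds cannot collide.
  have aux : ∀ {k l : ℕ}, k ∈ E → l ∉ E → k ≤ m → l ≤ m →
      up E (m + 1) a k = up E (m + 1) a l → False := by
    intro k l hk hl hkm hlm h
    have h1 := up_mem_insert (n := m + 1) (a := a) hk
    rw [h, up_of_not (fun h' => hl h'.1), Finset.mem_insert] at h1
    rcases h1 with h1 | h1
    · omega
    · exact hl h1
  by_cases hk : k ∈ E <;> by_cases hl : l ∈ E
  · rcases lt_trichotomy k l with hlt | rfl | hlt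
    · exact absurd h (up_lt_up hk hl hlt hlm).ne
    · rfl
    · exact absurd h (up_lt_up hl hk hlt hkm).ne'
  · exact (aux hk hl hkm hlm h).elim
  · exact (aux hl hk hlm hkm h.symm).elim
  · rwa [up_of_not (fun h' => hk h'.1), up_of_not (fun h' => hl h'.1)] at h

theorem up_ne_least {l : ℕ} (hlm : l ≤ m) : up E (m + 1) a l ≠ least E (m + 1) a := by
  by_cases h : l ∈ E ∧ a ≤ l
  · exact ((least_le h.1 h.2).trans_lt (lt_up h.1 h.2 hlm)).ne'
  · rw [up_of_not h]
    rintro rfl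
    rcases least_mem E (m + 1) a with h' | h'
    · omega
    · exact h h'

theorem least_lt_up {l : ℕ} (hl : l ∈ E) (hal : a ≤ l) (hlm : l ≤ m) :
    least E (m + 1) a < up E (m + 1) a l :=
  (least_le hl hal).trans_lt (lt_up hl hal hlm)

/-- The part of the chain from `a` on moves one step up, and the least element, thereby vacated, is
the inserted letter. Equality follows from inclusion and equal cardinalities. It is what makes `E`
recoverable from the output. -/
theorem insert_least_image_up (hE : ∀ e ∈ E, e ≤ m) :
    insert (least E (m + 1) a) (E.image (up E (m + 1) a)) = insert (m + 1) E := by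
  apply Finset.eq_of_subset_of_card_le
  · intro y hy
    rcases Finset.mem_insert.1 hy with rfl | hy
    · exact least_mem_insert
    · obtain ⟨l, hl, rfl⟩ := Finset.mem_image.1 hy
      exact up_mem_insert hl
  · rw [Finset.card_insert_of_notMem, Finset.card_insert_of_notMem,
      Finset.card_image_of_injOn]
    · exact fun k hk l hl h => up_inj (hE k hk) (hE l hl) h
    · intro h
      obtain ⟨l, hl, e⟩ := Finset.mem_image.1 h
      exact up_ne_least (hE l hl) e
    · intro h
      have := hE _ h
      omega

/-- No letter of `E` lies between `a` and the least element of the chain that is `≥ a`. So Han's map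
may be taken to raise from the space `x` instead of from the insertion letter. -/
theorem up_least_eq (ha : a ≤ m + 1) (l : ℕ) :
    up E (m + 1) (least E (m + 1) a) l = up E (m + 1) a l := by
  by_cases hl : l ∈ E ∧ a ≤ l
  · rw [up_of hl.1 hl.2, up_of hl.1 (least_le hl.1 hl.2)]
  · rw [up_of_not hl, up_of_not fun h => hl ⟨h.1, (le_least ha).trans h.2⟩]

end Up

/-! ### Rotating letters -/

/-- The effect on letters of `rotate`. -/
def rot (F : Finset ℕ) (l : ℕ) : ℕ :=
  if l ∈ F then if (F.filter fun f => f < l).Nonempty then pred F l else F.sup id else l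

section Rot
variable {F : Finset ℕ}

theorem rot_of_notMem {l : ℕ} (h : l ∉ F) : rot F l = l := if_neg h

theorem rot_of_lt {k l : ℕ} (hk : k ∈ F) (hl : l ∈ F) (h : k < l) : rot F l = pred F l := by
  rw [rot, if_pos hl, if_pos ⟨k, Finset.mem_filter.2 ⟨hk, h⟩⟩]

theorem rot_of_min {l : ℕ} (hl : l ∈ F) (h : ∀ k ∈ F, l ≤ k) : rot F l = F.sup id := by
  rw [rot, if_pos hl, if_neg]
  rintro ⟨k, hk⟩
  have := h k (Finset.mem_filter.1 hk).1
  have := (Finset.mem_filter.1 hk).2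
  omega

theorem sup_id_mem {l : ℕ} (hl : l ∈ F) : F.sup id ∈ F := by
  obtain ⟨k, hk, e⟩ := Finset.exists_mem_eq_sup F ⟨l, hl⟩ id
  rw [e]; exact hk

theorem rot_mem {l : ℕ} (hl : l ∈ F) : rot F l ∈ F := by
  rw [rot, if_pos hl]
  split_ifs with h
  · obtain ⟨k, hk⟩ := h
    exact (pred_mem (Finset.mem_filter.1 hk).1 (Finset.mem_filter.1 hk).2).1
  · exact sup_id_mem hl

theorem rot_mem_iff {l : ℕ} : rot F l ∈ F ↔ l ∈ F := by
  constructor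
  · intro h
    by_contra hl
    rw [rot_of_notMem hl] at h
    exact hl h
  · exact rot_mem

theorem rot_lt_rot {j k l : ℕ} (hj : j ∈ F) (hk : k ∈ F) (hl : l ∈ F) (hjk : j < k)
    (hkl : k < l) : rot F k < rot F l := by
  rw [rot_of_lt hj hk hjk, rot_of_lt hk hl hkl]
  exact pred_lt_pred hj hjk hk hkl

theorem rot_lt_sup {k l : ℕ} (hk : k ∈ F) (hl : l ∈ F) (h : k < l) : rot F l < F.sup id := by
  rw [rot_of_lt hk hl h]
  exact (pred_mem hk h).2.trans_le (Finset.le_sup (f := id) hl)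

/-- `rot` is a cyclic permutation of `F`: it is increasing on the non-minimal elements, and the
minimum goes above all their images. -/
theorem rot_inj {k l : ℕ} (h : rot F k = rot F l) : k = l := by
  have aux : ∀ {k l : ℕ}, k ∈ F → l ∈ F → k < l → rot F k ≠ rot F l := by
    intro k l hk hl hkl
    by_cases h : ∃ j ∈ F, j < k
    · obtain ⟨j, hj, hjk⟩ := h
      exact (rot_lt_rot hj hk hl hjk hkl).ne
    · push Not at h
      rw [rot_of_min hk h]
      exact (rot_lt_sup hk hl hkl).ne'
  by_cases hk : k ∈ F
  · have hl : l ∈ F := rot_mem_iff.1 (h ▸ rot_mem hk)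
    rcases lt_trichotomy k l with hlt | rfl | hlt
    · exact absurd h (aux hk hl hlt)
    · rfl
    · exact absurd h.symm (aux hl hk hlt)
  · have hl : l ∉ F := fun hl => hk (rot_mem_iff.1 (h ▸ rot_mem hl))
    rwa [rot_of_notMem hk, rot_of_notMem hl] at h

theorem image_rot_of_subset {L : Finset ℕ} (h : F ⊆ L) : L.image (rot F) = L := by
  apply Finset.eq_of_subset_of_card_le
  · intro y hy
    obtain ⟨l, hl, rfl⟩ := Finset.mem_image.1 hy
    by_cases hF : l ∈ F
    · exact h (rot_mem hF)
    · rwa [rot_of_notMem hF]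
  · rw [Finset.card_image_of_injOn (fun k _ l _ h => rot_inj h)]

theorem image_rot : F.image (rot F) = F := image_rot_of_subset subset_rfl

end Rot

/-! ### Inversions -/

section Inv
variable {P Q : Finset ℕ} {v w : ℕ → ℕ}

/-- An order isomorphism of places that respects the relative order of letters matches the
inversions. -/
theorem inv_congr {q : ℕ → ℕ} (hq : ∀ i ∈ P, q i ∈ Q)
    (hmono : ∀ i ∈ P, ∀ j ∈ P, i < j → q i < q j)
    (hsurj : ∀ k ∈ Q, ∃ i ∈ P, q i = k)
    (hlt : ∀ i ∈ P, ∀ j ∈ P, i < j → (v j < v i ↔ w (q j) < w (q i))) :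
    inv P v = inv Q w := by
  have hmono' : ∀ i ∈ P, ∀ j ∈ P, q i < q j → i < j := by
    intro i hi j hj h
    rcases lt_trichotomy i j with h' | rfl | h'
    · exact h'
    · exact absurd h (lt_irrefl _)
    · exact absurd h (hmono j hj i hi h').asymm
  have hinj : ∀ i ∈ P, ∀ j ∈ P, q i = q j → i = j := by
    intro i hi j hj h
    rcases lt_trichotomy i j with h' | rfl | h'
    · exact absurd h (hmono i hi j hj h').ne
    · rfl
    · exact absurd h (hmono j hj i hi h').ne'
  unfold inv
  refine Finset.card_bij (fun p _ => (q p.1, q p.2)) ?_ ?_ ?_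
  · rintro ⟨i, j⟩ h
    simp only [Finset.mem_filter, Finset.mem_product] at h ⊢
    exact ⟨⟨hq i h.1.1, hq j h.1.2⟩, hmono i h.1.1 j h.1.2 h.2.1,
      (hlt i h.1.1 j h.1.2 h.2.1).1 h.2.2⟩
  · rintro ⟨i, j⟩ h ⟨i', j'⟩ h' e
    simp only [Finset.mem_filter, Finset.mem_product] at h h'
    simp only [Prod.mk.injEq] at e ⊢
    exact ⟨hinj i h.1.1 i' h'.1.1 e.1, hinj j h.1.2 j' h'.1.2 e.2⟩
  · rintro ⟨k, l⟩ h
    simp only [Finset.mem_filter, Finset.mem_product] at h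
    obtain ⟨i, hi, rfl⟩ := hsurj k h.1.1
    obtain ⟨j, hj, rfl⟩ := hsurj l h.1.2
    have := hmono' i hi j hj h.2.1
    refine ⟨(i, j), ?_, rfl⟩
    simp only [Finset.mem_filter, Finset.mem_product]
    exact ⟨⟨hi, hj⟩, this, (hlt i hi j hj this).2 h.2.2⟩

theorem inv_insert {x : ℕ} (hx : x ∉ P) :
    inv (insert x P) w = inv P w + (P.filter fun i => i < x ∧ w x < w i).card +
      (P.filter fun i => x < i ∧ w i < w x).card := by
  have h : ((insert x P ×ˢ insert x P).filter fun p => p.1 < p.2 ∧ w p.2 < w p.1) =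
      (((P ×ˢ P).filter fun p => p.1 < p.2 ∧ w p.2 < w p.1) ∪
        (P.filter fun i => i < x ∧ w x < w i).image fun i => (i, x)) ∪
        (P.filter fun i => x < i ∧ w i < w x).image fun i => (x, i) := by
    ext ⟨i, j⟩
    simp only [Finset.mem_filter, Finset.mem_product, Finset.mem_insert, Finset.mem_union,
      Finset.mem_image, Prod.mk.injEq]
    constructor
    · rintro ⟨⟨rfl | hi, rfl | hj⟩, h1, h2⟩
      · exact absurd h1 (lt_irrefl _)
      · exact Or.inr ⟨j, ⟨hj, h1, h2⟩, rfl, rfl⟩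
      · exact Or.inl (Or.inr ⟨i, ⟨hi, h1, h2⟩, rfl, rfl⟩)
      · exact Or.inl (Or.inl ⟨⟨hi, hj⟩, h1, h2⟩)
    · rintro ((⟨⟨hi, hj⟩, h⟩ | ⟨k, ⟨hk, h⟩, rfl, rfl⟩) | ⟨k, ⟨hk, h⟩, rfl, rfl⟩)
      · exact ⟨⟨Or.inr hi, Or.inr hj⟩, h⟩
      · exact ⟨⟨Or.inr hk, Or.inl rfl⟩, h⟩
      · exact ⟨⟨Or.inl rfl, Or.inr hk⟩, h⟩
  unfold inv
  rw [h, Finset.card_union_of_disjoint, Finset.card_union_of_disjoint,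
    Finset.card_image_of_injective _ (fun i j h => (Prod.mk.inj h).1),
    Finset.card_image_of_injective _ (fun i j h => (Prod.mk.inj h).2)]
  · rw [Finset.disjoint_left]
    rintro ⟨i, j⟩ h1 h2
    simp only [Finset.mem_filter, Finset.mem_product, Finset.mem_image, Prod.mk.injEq] at h1 h2
    obtain ⟨k, _, rfl, rfl⟩ := h2
    exact hx h1.1.2
  · rw [Finset.disjoint_left]
    rintro ⟨i, j⟩ h1 h2
    simp only [Finset.mem_filter, Finset.mem_product, Finset.mem_image, Prod.mk.injEq,
      Finset.mem_union] at h1 h2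
    obtain ⟨k, h2, rfl, rfl⟩ := h2
    rcases h1 with h1 | ⟨l, h1, rfl, rfl⟩
    · exact hx h1.1.1
    · exact hx h1.1

/-- Splitting the inversions of a word into those of two consecutive factors and those between
them; the latter depend only on the set of the letters of the first factor. -/
theorem inv_union (hPQ : ∀ i ∈ P, ∀ j ∈ Q, i < j) (hinj : Set.InjOn w P) :
    inv (P ∪ Q) w = inv P w + inv Q w +
      ∑ j ∈ Q, ((P.image w).filter fun a => w j < a).card := by
  have h : (((P ∪ Q) ×ˢ (P ∪ Q)).filter fun p => p.1 < p.2 ∧ w p.2 < w p.1) =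
      (((P ×ˢ P).filter fun p => p.1 < p.2 ∧ w p.2 < w p.1) ∪
        ((Q ×ˢ Q).filter fun p => p.1 < p.2 ∧ w p.2 < w p.1)) ∪
        ((P ×ˢ Q).filter fun p => w p.2 < w p.1) := by
    ext ⟨i, j⟩
    simp only [Finset.mem_filter, Finset.mem_product, Finset.mem_union]
    constructor
    · rintro ⟨⟨hi | hi, hj | hj⟩, h1, h2⟩
      · exact Or.inl (Or.inl ⟨⟨hi, hj⟩, h1, h2⟩)
      · exact Or.inr ⟨⟨hi, hj⟩, h2⟩
      · exact absurd h1 (hPQ j hj i hi).asymm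
      · exact Or.inl (Or.inr ⟨⟨hi, hj⟩, h1, h2⟩)
    · rintro ((⟨⟨hi, hj⟩, h⟩ | ⟨⟨hi, hj⟩, h⟩) | ⟨⟨hi, hj⟩, h⟩)
      · exact ⟨⟨Or.inl hi, Or.inl hj⟩, h⟩
      · exact ⟨⟨Or.inr hi, Or.inr hj⟩, h⟩
      · exact ⟨⟨Or.inl hi, Or.inr hj⟩, hPQ i hi j hj, h⟩
  have hcross : ((P ×ˢ Q).filter fun p => w p.2 < w p.1).card =
      ∑ j ∈ Q, ((P.image w).filter fun a => w j < a).card := by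
    rw [Finset.card_filter, Finset.sum_product_right]
    apply Finset.sum_congr rfl
    intro j _
    rw [← Finset.card_filter, Finset.filter_image, Finset.card_image_of_injOn]
    exact fun i hi k hk => hinj (Finset.mem_filter.1 hi).1 (Finset.mem_filter.1 hk).1
  have hne : ∀ i ∈ P, i ∉ Q := fun i hi hi' => lt_irrefl _ (hPQ i hi i hi')
  unfold inv
  rw [h, Finset.card_union_of_disjoint, Finset.card_union_of_disjoint, hcross]
  · rw [Finset.disjoint_left]
    rintro ⟨i, j⟩ h1 h2
    simp only [Finset.mem_filter, Finset.mem_product] at h1 h2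
    exact hne i h1.1.1 h2.1.1
  · rw [Finset.disjoint_left]
    rintro ⟨i, j⟩ h1 h2
    simp only [Finset.mem_filter, Finset.mem_product, Finset.mem_union] at h1 h2
    rcases h1 with h1 | h1
    · exact hne j h1.1.2 h2.1.2
    · exact hne i h2.1.1 h1.1.1

end Inv

/-! ### Inserting a letter -/

/-- `q` maps the places of a word of length `m + 1` other than `x` bijectively to the places of a
word of length `m`. -/
structure PlaceMap (m x : ℕ) (q : ℕ → ℕ) : Prop where
  one_le : 1 ≤ x
  le : x ≤ m + 1
  maps : ∀ {i}, 1 ≤ i → i ≤ m + 1 → i ≠ x → 1 ≤ q i ∧ q i ≤ m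
  inj : ∀ {i j}, 1 ≤ i → i ≤ m + 1 → i ≠ x → 1 ≤ j → j ≤ m + 1 → j ≠ x → q i = q j → i = j

/-- The word with letter `v` at the place `x` and with letters `g (w (q i))` at the other places. -/
def insertLetter (x v : ℕ) (q g w : ℕ → ℕ) (i : ℕ) : ℕ := if i = x then v else g (w (q i))

section Insert
variable {r m x v : ℕ} {q g w τ : ℕ → ℕ}

@[simp] theorem insertLetter_self : insertLetter x v q g w x = v := if_pos rfl

theorem insertLetter_of_ne {i : ℕ} (h : i ≠ x) : insertLetter x v q g w i = g (w (q i)) := if_neg h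

theorem PlaceMap.surj (hq : PlaceMap m x q) {k : ℕ} (h1 : 1 ≤ k) (hk : k ≤ m) :
    ∃ i, (1 ≤ i ∧ i ≤ m + 1) ∧ i ≠ x ∧ q i = k := by
  obtain ⟨i, hi, e⟩ := exists_preimage (S := (Finset.Icc 1 (m + 1)).erase x)
    (T := Finset.Icc 1 m) (f := q)
    (fun i hi => by
      rw [Finset.mem_erase, Finset.mem_Icc] at hi
      exact Finset.mem_Icc.2 (hq.maps hi.2.1 hi.2.2 hi.1))
    (fun i hi j hj => by
      rw [Finset.mem_coe, Finset.mem_erase, Finset.mem_Icc] at hi hj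
      exact hq.inj hi.2.1 hi.2.2 hi.1 hj.2.1 hj.2.2 hj.1)
    (by rw [Finset.card_erase_of_mem (Finset.mem_Icc.2 ⟨hq.one_le, hq.le⟩)]; simp)
    (Finset.mem_Icc.2 ⟨h1, hk⟩)
  rw [Finset.mem_erase, Finset.mem_Icc] at hi
  exact ⟨i, hi.2, hi.1, e⟩

theorem PlaceMap.isWord_insertLetter (hq : PlaceMap m x q) (hw : IsWord m w)
    (hv1 : 1 ≤ v) (hv : v ≤ m + 1)
    (hg : ∀ l, 1 ≤ l → l ≤ m → 1 ≤ g l ∧ g l ≤ m + 1 ∧ g l ≠ v)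
    (hinj : ∀ k l, 1 ≤ k → k ≤ m → 1 ≤ l → l ≤ m → g k = g l → k = l) :
    IsWord (m + 1) (insertLetter x v q g w) := by
  have key : ∀ {i}, 1 ≤ i → i ≤ m + 1 → i ≠ x → 1 ≤ w (q i) ∧ w (q i) ≤ m := by
    intro i h1 h2 h3
    have := hq.maps h1 h2 h3
    exact ⟨hw.pos this.1 this.2, hw.le this.1 this.2⟩
  refine ⟨fun {i} h1 h2 => ?_, fun {i} h1 h2 => ?_, fun {i j} h1 h2 h3 h4 h => ?_⟩
  · by_cases h : i = x
    · rw [h, insertLetter_self]; exact hv1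
    · rw [insertLetter_of_ne h]
      have := key h1 h2 h
      exact (hg _ this.1 this.2).1
  · by_cases h : i = x
    · rw [h, insertLetter_self]; exact hv
    · rw [insertLetter_of_ne h]
      have := key h1 h2 h
      exact (hg _ this.1 this.2).2.1
  · by_cases hi : i = x <;> by_cases hj : j = x
    · rw [hi, hj]
    · rw [hi, insertLetter_self, insertLetter_of_ne hj] at h
      have := key h3 h4 hj
      exact absurd h.symm (hg _ this.1 this.2).2.2
    · rw [hj, insertLetter_self, insertLetter_of_ne hi] at h
      have := key h1 h2 hi
      exact absurd h (hg _ this.1 this.2).2.2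
    · rw [insertLetter_of_ne hi, insertLetter_of_ne hj] at h
      have a := key h1 h2 hi
      have b := key h3 h4 hj
      have c := hq.maps h1 h2 hi
      have d := hq.maps h3 h4 hj
      exact hq.inj h1 h2 hi h3 h4 hj (hw.inj c.1 c.2 d.1 d.2 (hinj _ _ a.1 a.2 b.1 b.2 h))

/-- Every place of the shorter word is some `q i` with `i ≠ x`. Thus, once `x`, `q` and `g` are
known from the output, so is the word. -/
theorem PlaceMap.cancel (hq : PlaceMap m x q) {w' : ℕ → ℕ} (hw : IsWord m w) (hw' : IsWord m w')
    (hinj : ∀ k l, 1 ≤ k → k ≤ m → 1 ≤ l → l ≤ m → g k = g l → k = l) {v' : ℕ}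
    (h : ∀ i, 1 ≤ i → i ≤ m + 1 → insertLetter x v q g w i = insertLetter x v' q g w' i)
    {i : ℕ} (h1 : 1 ≤ i) (h2 : i ≤ m) : w i = w' i := by
  obtain ⟨j, hj, hx, rfl⟩ := hq.surj h1 h2
  have := h j hj.1 hj.2
  rw [insertLetter_of_ne hx, insertLetter_of_ne hx] at this
  exact hinj _ _ (hw.pos h1 h2) (hw.le h1 h2) (hw'.pos h1 h2) (hw'.le h1 h2) this

theorem PlaceMap.image_erase (hq : PlaceMap m x q) {S T : Finset ℕ}
    (hS : S ⊆ Finset.Icc 1 (m + 1)) (hT : T ⊆ Finset.Icc 1 m)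
    (h : ∀ i, 1 ≤ i → i ≤ m + 1 → i ≠ x → (i ∈ S ↔ q i ∈ T)) : (S.erase x).image q = T := by
  ext k
  rw [Finset.mem_image]
  constructor
  · rintro ⟨i, hi, rfl⟩
    rw [Finset.mem_erase] at hi
    have := Finset.mem_Icc.1 (hS hi.2)
    exact (h i this.1 this.2 hi.1).1 hi.2
  · intro hk
    have := Finset.mem_Icc.1 (hT hk)
    obtain ⟨i, hi, hx, rfl⟩ := hq.surj this.1 this.2
    exact ⟨i, Finset.mem_erase.2 ⟨hx, (h i hi.1 hi.2 hx).2 hk⟩, rfl⟩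

theorem PlaceMap.injOn_erase (hq : PlaceMap m x q) {S : Finset ℕ}
    (hS : S ⊆ Finset.Icc 1 (m + 1)) : Set.InjOn q (S.erase x) := by
  intro i hi j hj h
  rw [Finset.mem_coe, Finset.mem_erase] at hi hj
  have a := Finset.mem_Icc.1 (hS hi.2)
  have b := Finset.mem_Icc.1 (hS hj.2)
  exact hq.inj a.1 a.2 hi.1 b.1 b.2 hj.1 h

theorem PlaceMap.card_erase (hq : PlaceMap m x q) {S T : Finset ℕ}
    (hS : S ⊆ Finset.Icc 1 (m + 1)) (hT : T ⊆ Finset.Icc 1 m)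
    (h : ∀ i, 1 ≤ i → i ≤ m + 1 → i ≠ x → (i ∈ S ↔ q i ∈ T)) : (S.erase x).card = T.card := by
  rw [← hq.image_erase hS hT h, Finset.card_image_of_injOn (hq.injOn_erase hS)]

theorem PlaceMap.inv_erase (hq : PlaceMap m x q) {S T : Finset ℕ}
    (hS : S ⊆ Finset.Icc 1 (m + 1)) (hT : T ⊆ Finset.Icc 1 m)
    (h : ∀ i, 1 ≤ i → i ≤ m + 1 → i ≠ x → (i ∈ S ↔ q i ∈ T))
    (hmono : ∀ i ∈ S, ∀ j ∈ S, i ≠ x → j ≠ x → i < j → q i < q j)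
    (hlt : ∀ i ∈ S, ∀ j ∈ S, i ≠ x → j ≠ x → (τ j < τ i ↔ w (q j) < w (q i))) :
    inv (S.erase x) τ = inv T w := by
  have him := hq.image_erase hS hT h
  apply inv_congr (q := q)
  · intro i hi
    rw [← him]
    exact Finset.mem_image_of_mem _ hi
  · intro i hi j hj hij
    rw [Finset.mem_erase] at hi hj
    exact hmono i hi.2 j hj.2 hi.1 hj.1 hij
  · intro k hk
    rw [← him] at hk
    exact Finset.mem_image.1 hk
  · intro i hi j hj _
    rw [Finset.mem_erase] at hi hj
    exact hlt i hi.2 j hj.2 hi.1 hj.1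

/-- The insertion `w ↦ τ` along the place map `q` preserves excedance places. -/
structure ExcTransfer (r m x : ℕ) (q w τ : ℕ → ℕ) : Prop extends PlaceMap m x q where
  exc_iff : ∀ i, 1 ≤ i → i ≤ m + 1 → i ≠ x → (i ∈ excPlaces r (m + 1) τ ↔ q i ∈ excPlaces r m w)

namespace ExcTransfer

theorem nonexc_iff (h : ExcTransfer r m x q w τ) (i : ℕ) (h1 : 1 ≤ i) (h2 : i ≤ m + 1)
    (hx : i ≠ x) : i ∈ nonexcPlaces r (m + 1) τ ↔ q i ∈ nonexcPlaces r m w := by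
  rw [mem_nonexcPlaces, mem_nonexcPlaces, h.exc_iff i h1 h2 hx]
  have := h.maps h1 h2 hx
  tauto

theorem image_exc (h : ExcTransfer r m x q w τ) :
    ((excPlaces r (m + 1) τ).erase x).image q = excPlaces r m w :=
  h.image_erase excPlaces_subset excPlaces_subset h.exc_iff

theorem excLetters_erase (h : ExcTransfer r m x q w τ)
    (hτ : ∀ i ∈ excPlaces r (m + 1) τ, i ≠ x → τ i = g (w (q i))) :
    ((excPlaces r (m + 1) τ).erase x).image τ = (excLetters r m w).image g := by
  rw [excLetters, ← h.image_exc, Finset.image_image, Finset.image_image]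
  apply Finset.image_congr
  intro i hi
  rw [Finset.mem_coe, Finset.mem_erase] at hi
  exact hτ i hi.2 hi.1

/-- The letter at `x` is added on both sides because `x` need not be an excedance place: in Han's
insertion it may become a fixed point. -/
theorem insert_excLetters (h : ExcTransfer r m x q w τ)
    (hτ : ∀ i ∈ excPlaces r (m + 1) τ, i ≠ x → τ i = g (w (q i))) :
    insert (τ x) (excLetters r (m + 1) τ) = insert (τ x) ((excLetters r m w).image g) := by
  rw [← h.excLetters_erase hτ, excLetters]
  ext y
  simp only [Finset.mem_insert, Finset.mem_image, Finset.mem_erase]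
  constructor
  · rintro (rfl | ⟨i, hi, rfl⟩)
    · exact Or.inl rfl
    · by_cases hx : i = x
      · exact Or.inl (by rw [hx])
      · exact Or.inr ⟨i, ⟨hx, hi⟩, rfl⟩
  · rintro (rfl | ⟨i, hi, rfl⟩)
    · exact Or.inl rfl
    · exact Or.inr ⟨i, hi.2, rfl⟩

theorem inv_nonexc (h : ExcTransfer r m x q w τ)
    (hmono : ∀ i ∈ nonexcPlaces r (m + 1) τ, ∀ j ∈ nonexcPlaces r (m + 1) τ,
      i ≠ x → j ≠ x → i < j → q i < q j)
    (hτ : ∀ i ∈ nonexcPlaces r (m + 1) τ, i ≠ x → τ i = w (q i)) :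
    inv ((nonexcPlaces r (m + 1) τ).erase x) τ = inv (nonexcPlaces r m w) w :=
  h.inv_erase nonexcPlaces_subset nonexcPlaces_subset h.nonexc_iff hmono
    fun i hi j hj hix hjx => by rw [hτ i hi hix, hτ j hj hjx]

end ExcTransfer

/-! ### Counting letters of a permutation -/

theorem IsWord.card_letters_lt (hw : IsWord m w) (h1 : 1 ≤ x) (hx : x ≤ m + 1) :
    ((Finset.Icc 1 m).filter fun j => w j < x).card = x - 1 := by
  have : ((Finset.Icc 1 m).filter fun j => w j < x).image w = Finset.Icc 1 (x - 1) := by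
    ext l
    simp only [Finset.mem_image, Finset.mem_filter, Finset.mem_Icc]
    constructor
    · rintro ⟨j, ⟨hj, hl⟩, rfl⟩
      have := hw.pos hj.1 hj.2
      omega
    · rintro ⟨ha, hb⟩
      obtain ⟨j, h1, h2, rfl⟩ := hw.surj ha (by omega)
      exact ⟨j, ⟨⟨h1, h2⟩, by omega⟩, rfl⟩
  rw [← Finset.card_image_of_injOn (hw.injOn (Finset.filter_subset _ _)), this]
  simp

/-- There are `x - 1` places below `x` and `x - 1` letters below `x`; removing the places below `x`
that carry letters below `x` leaves equally many on both sides. -/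
theorem IsWord.card_crossing (hw : IsWord m w) (h1 : 1 ≤ x) (hx : x ≤ m + 1) :
    ((Finset.Icc 1 m).filter fun j => j < x ∧ x ≤ w j).card =
      ((Finset.Icc 1 m).filter fun j => x ≤ j ∧ w j < x).card := by
  have e1 := hw.card_letters_lt h1 hx
  have e2 : ((Finset.Icc 1 m).filter fun j => j < x).card = x - 1 := by
    have : ((Finset.Icc 1 m).filter fun j => j < x) = Finset.Icc 1 (x - 1) := by
      ext j
      simp only [Finset.mem_filter, Finset.mem_Icc]
      omega
    rw [this]; simp
  have e3 := Finset.card_filter_add_card_filter_not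
    (s := (Finset.Icc 1 m).filter fun j => w j < x) (fun j => x ≤ j)
  have e4 := Finset.card_filter_add_card_filter_not
    (s := (Finset.Icc 1 m).filter fun j => j < x) (fun j => x ≤ w j)
  rw [Finset.filter_filter, Finset.filter_filter] at e3 e4
  have e5 : ((Finset.Icc 1 m).filter fun j => w j < x ∧ ¬ x ≤ j) =
      ((Finset.Icc 1 m).filter fun j => j < x ∧ ¬ x ≤ w j) :=
    Finset.filter_congr fun j _ => by omega
  have e6 : ((Finset.Icc 1 m).filter fun j => w j < x ∧ x ≤ j) =
      ((Finset.Icc 1 m).filter fun j => x ≤ j ∧ w j < x) :=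
    Finset.filter_congr fun j _ => by omega
  rw [e5, e6] at e3
  omega

/-- Splits the letters by whether their place is `≥ x`, where the excedance condition already makes
the letter large. The first part counts the excedance places that an insertion at `x` shifts, the
second the larger excedance letters on its left. -/
theorem IsWord.card_excLetters_ge (hw : IsWord m w) (x : ℕ) :
    ((excLetters r m w).filter fun e => x ≤ e).card =
      ((excPlaces r m w).filter fun j => x ≤ j).card +
        ((excPlaces r m w).filter fun j => j < x ∧ x ≤ w j).card := by
  rw [excLetters, Finset.filter_image, Finset.card_image_of_injOn
    (hw.injOn ((Finset.filter_subset _ _).trans excPlaces_subset)),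
    ← Finset.card_union_of_disjoint]
  · congr 1
    ext j
    simp only [Finset.mem_filter, Finset.mem_union, mem_excPlaces]
    omega
  · rw [Finset.disjoint_left]
    intro j
    simp only [Finset.mem_filter]
    omega

end Insert

/-! ### Han's insertion -/

/-- The place map of an insertion before the place `x`. -/
def shift (x i : ℕ) : ℕ := if i < x then i else i - 1

section Han
variable {r m x : ℕ} {w : ℕ → ℕ}

theorem shift_of_lt {i : ℕ} (h : i < x) : shift x i = i := if_pos h

theorem shift_of_gt {i : ℕ} (h : x < i) : shift x i = i - 1 := if_neg h.asymm

theorem placeMap_shift (h1 : 1 ≤ x) (hx : x ≤ m + 1) : PlaceMap m x (shift x) := by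
  refine ⟨h1, hx, fun {i} _ _ _ => ?_, fun {i j} _ _ _ _ _ _ => ?_⟩ <;>
  · unfold shift
    split_ifs <;> omega

/-- Han's insertion at the place `x`. -/
def hanInsert (r m x : ℕ) (w : ℕ → ℕ) : ℕ → ℕ :=
  insertLetter x (least (excLetters r m w) (m + 1) x) (shift x) (up (excLetters r m w) (m + 1) x) w

theorem hanInsert_self : hanInsert r m x w x = least (excLetters r m w) (m + 1) x :=
  insertLetter_self

theorem hanInsert_of_ne {i : ℕ} (h : i ≠ x) :
    hanInsert r m x w i = up (excLetters r m w) (m + 1) x (w (shift x i)) :=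
  insertLetter_of_ne h

theorem up_bounds {E : Finset ℕ} {a : ℕ} (l : ℕ) (h1 : 1 ≤ l) (h2 : l ≤ m) :
    1 ≤ up E (m + 1) a l ∧ up E (m + 1) a l ≤ m + 1 ∧ up E (m + 1) a l ≠ least E (m + 1) a :=
  ⟨h1.trans (le_up h2), up_le h2, up_ne_least h2⟩

theorem IsWord.hanInsert (hw : IsWord m w) (h1 : 1 ≤ x) (hx : x ≤ m + 1) :
    IsWord (m + 1) (hanInsert r m x w) :=
  (placeMap_shift h1 hx).isWord_insertLetter hw (h1.trans (le_least hx)) least_le_right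
    up_bounds fun _ _ _ hk _ hl => up_inj hk hl

/-- A shift to the right by one could only spoil an excedance `w j = j + 1` with `j ≥ x`, and
exactly such letters are raised. Other letters are not in `E` and keep their value. -/
theorem IsWord.excTransfer_hanInsert (hw : IsWord m w) (h1 : 1 ≤ x) (hx : x ≤ m + 1) :
    ExcTransfer r m x (shift x) w (RDenert.hanInsert r m x w) := by
  refine ⟨placeMap_shift h1 hx, fun i hi1 hi2 hix => ?_⟩
  have hb := (placeMap_shift h1 hx).maps hi1 hi2 hix
  have hE := hw.mem_excLetters (r := r) hb.1 hb.2
  have hle := hw.le hb.1 hb.2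
  rw [mem_excPlaces, hanInsert_of_ne hix]
  by_cases hexc : shift x i ∈ excPlaces r m w
  · have h := mem_excPlaces.1 hexc
    have h3 := le_up (E := excLetters r m w) (a := x) hle
    refine ⟨fun _ => hexc, fun _ => ⟨⟨hi1, hi2⟩, ?_, h.2.2.trans h3⟩⟩
    rcases lt_or_gt_of_ne hix with hlt | hgt
    · rw [shift_of_lt hlt] at *
      omega
    -- Right of `x` the old place is `≥ x`, so its excedance letter exceeds `x` and is raised
    -- strictly.
    · have h4 := lt_up (E := excLetters r m w) (a := x) (hE.2 hexc)
        (by rw [shift_of_gt hgt] at h ⊢; omega) hle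
      rw [shift_of_gt hgt] at *
      omega
  · rw [up_of_not fun h => hexc (hE.1 h.1)]
    rw [mem_excPlaces] at hexc ⊢
    rcases lt_or_gt_of_ne hix with hlt | hgt
    · rw [shift_of_lt hlt] at *
      omega
    · rw [shift_of_gt hgt] at *
      omega

theorem shift_lt_shift {i j : ℕ} (hi : i ≠ x) (hj : j ≠ x) (h : i < j) : shift x i < shift x j := by
  unfold shift
  split_ifs <;> omega

theorem IsWord.hanInsert_of_nonexc (hw : IsWord m w) (h1 : 1 ≤ x) (hx : x ≤ m + 1) {i : ℕ}
    (hi : i ∈ nonexcPlaces r (m + 1) (RDenert.hanInsert r m x w)) (hix : i ≠ x) :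
    RDenert.hanInsert r m x w i = w (shift x i) := by
  have hi1 := (mem_nonexcPlaces.1 hi).1
  have h := hw.excTransfer_hanInsert (r := r) h1 hx
  have hb := h.maps hi1.1 hi1.2 hix
  rw [h.nonexc_iff i hi1.1 hi1.2 hix, mem_nonexcPlaces] at hi
  rw [hanInsert_of_ne hix, up_of_not]
  intro h'
  exact hi.2 ((hw.mem_excLetters hb.1 hb.2).1 h'.1)

theorem IsWord.inv_nonexc_hanInsert (hw : IsWord m w) (h1 : 1 ≤ x) (hx : x ≤ m + 1) :
    inv ((nonexcPlaces r (m + 1) (RDenert.hanInsert r m x w)).erase x) (RDenert.hanInsert r m x w) =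
      inv (nonexcPlaces r m w) w :=
  (hw.excTransfer_hanInsert h1 hx).inv_nonexc (fun _ _ _ _ hi hj hij => shift_lt_shift hi hj hij)
    fun _ hi hix => hw.hanInsert_of_nonexc h1 hx hi hix

theorem IsWord.inv_exc_hanInsert (hw : IsWord m w) (h1 : 1 ≤ x) (hx : x ≤ m + 1) :
    inv ((excPlaces r (m + 1) (RDenert.hanInsert r m x w)).erase x) (RDenert.hanInsert r m x w) =
      inv (excPlaces r m w) w := by
  have h := hw.excTransfer_hanInsert (r := r) h1 hx
  refine h.inv_erase excPlaces_subset excPlaces_subset h.exc_iff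
    (fun _ _ _ _ hi hj hij => shift_lt_shift hi hj hij) fun i hi j hj hix hjx => ?_
  have a := (mem_excPlaces.1 hi).1
  have b := (mem_excPlaces.1 hj).1
  have a' := h.maps a.1 a.2 hix
  have b' := h.maps b.1 b.2 hjx
  rw [hanInsert_of_ne hix, hanInsert_of_ne hjx]
  rw [h.exc_iff i a.1 a.2 hix] at hi
  rw [h.exc_iff j b.1 b.2 hjx] at hj
  exact up_lt_up_iff ((hw.mem_excLetters b'.1 b'.2).2 hj) ((hw.mem_excLetters a'.1 a'.2).2 hi)
    (hw.le b'.1 b'.2) (hw.le a'.1 a'.2)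

theorem IsWord.sum_exc_hanInsert (hw : IsWord m w) (h1 : 1 ≤ x) (hx : x ≤ m + 1) :
    ∑ i ∈ (excPlaces r (m + 1) (RDenert.hanInsert r m x w)).erase x, i =
      ∑ j ∈ excPlaces r m w, j + ((excPlaces r m w).filter fun j => x ≤ j).card := by
  have h := hw.excTransfer_hanInsert (r := r) h1 hx
  rw [Finset.card_filter, ← Finset.sum_add_distrib]
  rw [← h.image_exc, Finset.sum_image (h.injOn_erase excPlaces_subset)]
  apply Finset.sum_congr rfl
  intro i hi
  rw [Finset.mem_erase] at hi
  unfold shift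
  split_ifs <;> omega

theorem IsWord.exc_hanInsert (hw : IsWord m w) (hr : 1 ≤ r) (h1 : r ≤ x) (hx : x ≤ m + 1) :
    exc r (m + 1) (RDenert.hanInsert r m x w) =
      exc r m w + if x = least (excLetters r m w) (m + 1) x then 0 else 1 := by
  have h := hw.excTransfer_hanInsert (r := r) (by omega) hx
  have hc := h.card_erase (S := highPlaces r (m + 1) (RDenert.hanInsert r m x w))
    (T := highPlaces r m w) (Finset.filter_subset _ _) (Finset.filter_subset _ _)
    (fun i hi1 hi2 hix => by
      have h2 := h.exc_iff i hi1 hi2 hix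
      have h3 := h.maps hi1 hi2 hix
      have h4 : r ≤ i ↔ r ≤ shift x i := by
        unfold shift
        split_ifs <;> omega
      rw [mem_excPlaces, mem_excPlaces] at h2
      rw [mem_highPlaces, mem_highPlaces]
      omega)
  have hl := le_least (E := excLetters r m w) hx
  rw [exc_eq_card, exc_eq_card, ← hc]
  split_ifs with hxv
  · rw [Finset.erase_eq_of_notMem, add_zero]
    rw [mem_highPlaces, hanInsert_self]
    omega
  · rw [Finset.card_erase_add_one]
    rw [mem_highPlaces, hanInsert_self]
    omega

/-- The fixed point `x` creates inversions with the smaller letters to its right, all at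
non-excedance places. By `card_crossing` they are as many as the letters `≥ x` to its left; with the
shifted excedance places they count all excedance letters `≥ x`. -/
theorem IsWord.den_hanInsert_of_fixed (hw : IsWord m w) (hr : 1 ≤ r) (h1 : r ≤ x) (hx : x ≤ m + 1)
    (hxv : x = least (excLetters r m w) (m + 1) x) :
    den r (m + 1) (RDenert.hanInsert r m x w) =
      den r m w + ((excLetters r m w).filter fun e => x ≤ e).card := by
  have hx1 : 1 ≤ x := hr.trans h1
  have h := hw.excTransfer_hanInsert (r := r) hx1 hx
  have e1 := hw.sum_exc_hanInsert (r := r) hx1 hx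
  have e2 := hw.inv_exc_hanInsert (r := r) hx1 hx
  have e3 := hw.inv_nonexc_hanInsert (r := r) hx1 hx
  have hself : RDenert.hanInsert r m x w x = x := by rw [hanInsert_self]; exact hxv.symm
  have hnot : x ∉ excPlaces r (m + 1) (RDenert.hanInsert r m x w) := by
    rw [mem_excPlaces, hself]; omega
  have hmem : x ∈ nonexcPlaces r (m + 1) (RDenert.hanInsert r m x w) :=
    mem_nonexcPlaces.2 ⟨⟨hx1, hx⟩, hnot⟩
  rw [Finset.erase_eq_of_notMem hnot] at e1 e2
  have e4 := inv_insert (w := RDenert.hanInsert r m x w)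
    (Finset.notMem_erase x (nonexcPlaces r (m + 1) (RDenert.hanInsert r m x w)))
  rw [Finset.insert_erase hmem, e3, hself] at e4
  -- A letter above `x` at a place left of `x ≥ r` would be an `r`-level excedance.
  have e5 : (((nonexcPlaces r (m + 1) (RDenert.hanInsert r m x w)).erase x).filter
      fun i => i < x ∧ x < RDenert.hanInsert r m x w i) = ∅ := by
    apply Finset.filter_false_of_mem
    rintro i hi ⟨hi1, hi2⟩
    rw [Finset.mem_erase, mem_nonexcPlaces, mem_excPlaces] at hi
    omega
  have e6 : (((nonexcPlaces r (m + 1) (RDenert.hanInsert r m x w)).erase x).filter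
      fun i => x < i ∧ RDenert.hanInsert r m x w i < x).card =
      ((Finset.Icc 1 m).filter fun j => x ≤ j ∧ w j < x).card := by
    rw [← h.card_erase (S := (nonexcPlaces r (m + 1) (RDenert.hanInsert r m x w)).filter
      fun i => x < i ∧ RDenert.hanInsert r m x w i < x)
      ((Finset.filter_subset _ _).trans nonexcPlaces_subset) (Finset.filter_subset _ _)]
    · rw [Finset.filter_erase]
    · intro i hi1 hi2 hix
      have hb := h.maps hi1 hi2 hix
      rw [Finset.mem_filter, Finset.mem_filter, Finset.mem_Icc]
      have h5 : x < i ↔ x ≤ shift x i := by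
        unfold shift
        split_ifs <;> omega
      constructor
      · rintro ⟨a, b, c⟩
        rw [hw.hanInsert_of_nonexc hx1 hx a hix] at c
        exact ⟨hb, h5.1 b, c⟩
      · rintro ⟨-, b, c⟩
        have a : i ∈ nonexcPlaces r (m + 1) (RDenert.hanInsert r m x w) := by
          rw [h.nonexc_iff i hi1 hi2 hix, mem_nonexcPlaces, mem_excPlaces]
          omega
        exact ⟨a, h5.2 b, by rwa [hw.hanInsert_of_nonexc hx1 hx a hix]⟩
  have e7 : ((excPlaces r m w).filter fun j => j < x ∧ x ≤ w j) =
      (Finset.Icc 1 m).filter fun j => j < x ∧ x ≤ w j := by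
    ext j
    rw [Finset.mem_filter, Finset.mem_filter, mem_excPlaces, Finset.mem_Icc]
    omega
  have e8 := hw.card_crossing hx1 hx
  have e9 := hw.card_excLetters_ge (r := r) x
  rw [e5, e6, Finset.card_empty] at e4
  rw [e7] at e9
  unfold den
  omega

/-- The place `x` enters the sum, the shifted excedance places add one each, and the new letter is
inverted exactly with the old excedance letters `≥ x` on its left, which have been raised above it.
-/
theorem IsWord.den_hanInsert_of_exc (hw : IsWord m w) (hr : 1 ≤ r) (h1 : r ≤ x) (hx : x ≤ m + 1)
    (hxv : x ≠ least (excLetters r m w) (m + 1) x) :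
    den r (m + 1) (RDenert.hanInsert r m x w) =
      den r m w + (x + ((excLetters r m w).filter fun e => x ≤ e).card) := by
  have hx1 : 1 ≤ x := hr.trans h1
  have h := hw.excTransfer_hanInsert (r := r) hx1 hx
  have e1 := hw.sum_exc_hanInsert (r := r) hx1 hx
  have e2 := hw.inv_exc_hanInsert (r := r) hx1 hx
  have e3 := hw.inv_nonexc_hanInsert (r := r) hx1 hx
  have hl := le_least (E := excLetters r m w) hx
  have hmem : x ∈ excPlaces r (m + 1) (RDenert.hanInsert r m x w) := by
    rw [mem_excPlaces, hanInsert_self]; omega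
  have hnot : x ∉ nonexcPlaces r (m + 1) (RDenert.hanInsert r m x w) := fun h' =>
    (mem_nonexcPlaces.1 h').2 hmem
  rw [Finset.erase_eq_of_notMem hnot] at e3
  have e4 := inv_insert (w := RDenert.hanInsert r m x w)
    (Finset.notMem_erase x (excPlaces r (m + 1) (RDenert.hanInsert r m x w)))
  rw [Finset.insert_erase hmem, e2] at e4
  have e0 := Finset.add_sum_erase (excPlaces r (m + 1) (RDenert.hanInsert r m x w)) (fun i => i) hmem
  have hup : ∀ i ∈ excPlaces r (m + 1) (RDenert.hanInsert r m x w), i ≠ x →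
      (RDenert.hanInsert r m x w x < RDenert.hanInsert r m x w i ↔ x ≤ w (shift x i)) := by
    intro i hi hix
    have a := (mem_excPlaces.1 hi).1
    have a' := h.maps a.1 a.2 hix
    rw [h.exc_iff i a.1 a.2 hix] at hi
    have hE := (hw.mem_excLetters a'.1 a'.2).2 hi
    rw [hanInsert_self, hanInsert_of_ne hix]
    constructor
    · intro h5
      by_contra h6
      rw [up_of_not (by omega)] at h5
      omega
    · exact fun h5 => least_lt_up hE h5 (hw.le a'.1 a'.2)
  -- An excedance right of `x` comes from a place `≥ x`, so its letter was raised above the new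
  -- letter.
  have e5 : (((excPlaces r (m + 1) (RDenert.hanInsert r m x w)).erase x).filter
      fun i => x < i ∧ RDenert.hanInsert r m x w i < RDenert.hanInsert r m x w x) = ∅ := by
    apply Finset.filter_false_of_mem
    rintro i hi ⟨hi1, hi2⟩
    rw [Finset.mem_erase] at hi
    have a := (mem_excPlaces.1 hi.2).1
    have h3 := hup i hi.2 hi.1
    have h4 := hi.2
    rw [h.exc_iff i a.1 a.2 hi.1, mem_excPlaces, shift_of_gt hi1] at h4
    rw [shift_of_gt hi1] at h3
    omega
  have e6 : (((excPlaces r (m + 1) (RDenert.hanInsert r m x w)).erase x).filter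
      fun i => i < x ∧ RDenert.hanInsert r m x w x < RDenert.hanInsert r m x w i).card =
      ((excPlaces r m w).filter fun j => j < x ∧ x ≤ w j).card := by
    rw [← h.card_erase (S := (excPlaces r (m + 1) (RDenert.hanInsert r m x w)).filter
      fun i => i < x ∧ RDenert.hanInsert r m x w x < RDenert.hanInsert r m x w i)
      ((Finset.filter_subset _ _).trans excPlaces_subset)
      ((Finset.filter_subset _ _).trans excPlaces_subset)]
    · rw [Finset.filter_erase]
    · intro i hi1 hi2 hix
      rw [Finset.mem_filter, Finset.mem_filter, ← h.exc_iff i hi1 hi2 hix]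
      have h5 : i < x ↔ shift x i < x := by
        unfold shift
        split_ifs <;> omega
      constructor
      · rintro ⟨a, b, c⟩
        exact ⟨a, h5.1 b, (hup i a hix).1 c⟩
      · rintro ⟨a, b, c⟩
        exact ⟨a, h5.2 b, (hup i a hix).2 c⟩
  have e9 := hw.card_excLetters_ge (r := r) x
  rw [e5, e6, Finset.card_empty] at e4
  unfold den
  omega

end Han

/-! ### Pushing letters along a set of places -/

/-- The place map of `push`. -/
def pushPlace (P : Finset ℕ) (r x i : ℕ) : ℕ :=
  if i ≤ r then if x < i ∧ (i ∈ P ∨ i = r) then pred P i else i else i - 1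

section Push
variable {P : Finset ℕ} {r m x : ℕ}

theorem pushPlace_of_gt {i : ℕ} (h : r < i) : pushPlace P r x i = i - 1 := if_neg (by omega)

theorem pushPlace_of_notMem {i : ℕ} (h : i < r) (hi : i ∉ P) : pushPlace P r x i = i := by
  rw [pushPlace, if_pos h.le, if_neg]
  rintro ⟨-, h' | h'⟩
  · exact hi h'
  · omega

theorem pushPlace_of_lt {i : ℕ} (h : i ≤ r) (hi : i < x) : pushPlace P r x i = i := by
  rw [pushPlace, if_pos h, if_neg fun h' => hi.asymm h'.1]

theorem pushPlace_of_mem {i : ℕ} (h : i ≤ r) (hi : i ∈ P ∨ i = r) (hx : x < i) :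
    pushPlace P r x i = pred P i := by
  rw [pushPlace, if_pos h, if_pos ⟨hx, hi⟩]

theorem pushPlace_mem (hx : x ∈ P) (hP : ∀ j ∈ P, 1 ≤ j ∧ j < r) {i : ℕ} (hi : i ∈ P ∨ i = r)
    (hix : i ≠ x) : pushPlace P r x i ∈ P ∧ pushPlace P r x i ≤ i := by
  have hir : i ≤ r := by
    rcases hi with h | h
    · exact (hP i h).2.le
    · exact h.le
  rcases lt_or_gt_of_ne hix with h | h
  · rw [pushPlace_of_lt hir h]
    have := (hP x hx).2
    exact ⟨hi.resolve_right (by omega), le_rfl⟩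
  · rw [pushPlace_of_mem hir hi h]
    have := pred_mem hx h
    exact ⟨this.1, this.2.le⟩

/-- On `P` and the places from `r` on, letters only move right without overtaking. This covers the
excedance places when `P = 𝒜` and the non-excedance places when `P = ℬ`. -/
theorem pushPlace_lt_pushPlace (hx : x ∈ P) (hP : ∀ j ∈ P, 1 ≤ j ∧ j < r) {i j : ℕ}
    (hi : i ∈ P ∨ r ≤ i) (hj : j ∈ P ∨ r ≤ j) (hix : i ≠ x) (hjx : j ≠ x) (hij : i < j) :
    pushPlace P r x i < pushPlace P r x j := by
  rcases lt_or_ge r j with hrj | hrj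
  · rw [pushPlace_of_gt hrj]
    rcases lt_or_ge r i with hri | hri
    · rw [pushPlace_of_gt hri]; omega
    · have := (hP _ (pushPlace_mem hx hP (i := i) (hi.imp id fun h => le_antisymm hri h) hix).1).2
      omega
  · have hi' : i ∈ P := hi.resolve_right (by omega)
    have hj' : j ∈ P ∨ j = r := hj.imp id fun h => le_antisymm hrj h
    rcases lt_or_gt_of_ne hjx with h | h
    · rwa [pushPlace_of_lt hrj h, pushPlace_of_lt (by omega) (by omega)]
    · rw [pushPlace_of_mem hrj hj' h]
      rcases lt_or_gt_of_ne hix with h' | h'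
      · rw [pushPlace_of_lt (by omega) h']
        exact h'.trans_le (le_pred hx h)
      · rw [pushPlace_of_mem (by omega) (Or.inl hi') h']
        exact pred_lt_pred hx h' hi' hij

/-- Serves the complementary case: for `P = 𝒜` the non-excedance places avoid both `𝒜` and `r`. -/
theorem pushPlace_lt_pushPlace' {i j : ℕ}
    (hi : i ∉ P) (hj : j ∉ P) (hir : i ≠ r) (hjr : j ≠ r) (hij : i < j) :
    pushPlace P r x i < pushPlace P r x j := by
  rcases lt_or_gt_of_ne hjr with h | h
  · rwa [pushPlace_of_notMem h hj, pushPlace_of_notMem (hij.trans h) hi]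
  · rw [pushPlace_of_gt h]
    rcases lt_or_gt_of_ne hir with h' | h'
    · rw [pushPlace_of_notMem h' hi]; omega
    · rw [pushPlace_of_gt h']; omega

theorem placeMap_pushPlace (hx : x ∈ P) (hP : ∀ j ∈ P, 1 ≤ j ∧ j < r) (hr : r ≤ m) :
    PlaceMap m x (pushPlace P r x) := by
  have hxr := hP x hx
  refine ⟨hxr.1, by omega, fun {i} h1 h2 hix => ?_, fun {i j} h1 h2 hix h3 h4 hjx h => ?_⟩
  · by_cases hi : i ∈ P ∨ i = r
    · have := hP _ (pushPlace_mem hx hP hi hix).1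
      omega
    · push Not at hi
      rcases lt_or_gt_of_ne hi.2 with h | h
      · rw [pushPlace_of_notMem h hi.1]; omega
      · rw [pushPlace_of_gt h]; omega
  · have aux : ∀ {i j}, i ∈ P ∨ i = r → ¬ (j ∈ P ∨ j = r) → i ≠ x →
        pushPlace P r x i ≠ pushPlace P r x j := by
      intro i j hi hj hix h
      have h5 := (pushPlace_mem hx hP hi hix).1
      push Not at hj
      rcases lt_or_gt_of_ne hj.2 with h' | h'
      · rw [h, pushPlace_of_notMem h' hj.1] at h5
        exact hj.1 h5
      · rw [h, pushPlace_of_gt h'] at h5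
        have := hP _ h5
        omega
    by_cases hi : i ∈ P ∨ i = r <;> by_cases hj : j ∈ P ∨ j = r
    · have hi' : i ∈ P ∨ r ≤ i := hi.imp id fun h => h.ge
      have hj' : j ∈ P ∨ r ≤ j := hj.imp id fun h => h.ge
      rcases lt_trichotomy i j with hlt | rfl | hlt
      · exact absurd h (pushPlace_lt_pushPlace hx hP hi' hj' hix hjx hlt).ne
      · rfl
      · exact absurd h (pushPlace_lt_pushPlace hx hP hj' hi' hjx hix hlt).ne'
    · exact absurd h (aux hi hj hix)
    · exact absurd h.symm (aux hj hi hjx)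
    · push Not at hi hj
      rcases lt_trichotomy i j with hlt | rfl | hlt
      · exact absurd h (pushPlace_lt_pushPlace' hi.1 hj.1 hi.2 hj.2 hlt).ne
      · rfl
      · exact absurd h (pushPlace_lt_pushPlace' hj.1 hi.1 hj.2 hi.2 hlt).ne'

theorem push_eq_insertLetter (hx : x ∈ P) (hP : ∀ j ∈ P, 1 ≤ j ∧ j < r) (v : ℕ) (g w : ℕ → ℕ) :
    push P r x v (fun i => g (w i)) = insertLetter x v (pushPlace P r x) g w := by
  have hxr := (hP x hx).2
  funext i
  unfold push insertBefore
  rcases lt_trichotomy i r with h | rfl | h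
  · simp only [if_pos h]
    by_cases hix : i = x
    · rw [if_pos hix, hix, insertLetter_self]
    · rw [if_neg hix, insertLetter_of_ne hix]
      split_ifs with h'
      · rw [pushPlace_of_mem h.le (Or.inl h'.1) h'.2]; rfl
      · by_cases hi : i ∈ P
        · rw [pushPlace_of_lt h.le (by
            have : ¬ x < i := fun h2 => h' ⟨hi, h2⟩
            omega)]
        · rw [pushPlace_of_notMem h hi]
  -- Place `r` acts as the end of the chain `P ∪ {r}`: its predecessor is the maximum of `P`, whose
  -- letter is the one inserted before `w_r`.
  · rw [if_neg (lt_irrefl _), if_pos rfl, insertLetter_of_ne hxr.ne',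
      pushPlace_of_mem le_rfl (Or.inr rfl) hxr, pred_eq_sup fun j hj => (hP j hj).2]
  · rw [if_neg h.asymm, if_neg h.ne', insertLetter_of_ne (by omega), pushPlace_of_gt h]
    dsimp only
    rw [if_neg (by omega), if_neg]
    rintro ⟨h1, -⟩
    have := hP _ h1
    omega

end Push

/-! ### Insertion at a place of `𝒜` -/

section Alpha
variable {r m x : ℕ} {w : ℕ → ℕ}

/-- The insertion at a place `x` of `𝒜`. -/
def alphaInsert (r m x : ℕ) (w : ℕ → ℕ) : ℕ → ℕ :=
  insertLetter x (least (excLetters r m w) (m + 1) 0) (pushPlace (setA r m w) r x)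
    (up (excLetters r m w) (m + 1) 0) w

theorem alphaInsert_self : alphaInsert r m x w x = least (excLetters r m w) (m + 1) 0 :=
  insertLetter_self

theorem alphaInsert_of_ne {i : ℕ} (h : i ≠ x) : alphaInsert r m x w i =
    up (excLetters r m w) (m + 1) 0 (w (pushPlace (setA r m w) r x i)) :=
  insertLetter_of_ne h

theorem setA_bounds : ∀ j ∈ setA r m w, 1 ≤ j ∧ j < r := fun j hj => by
  rw [mem_setA] at hj; omega

theorem setB_bounds : ∀ j ∈ setB r m w, 1 ≤ j ∧ j < r := fun j hj => by
  rw [mem_setB] at hj; omega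

theorem setA_subset_excPlaces : setA r m w ⊆ excPlaces r m w := by
  rw [excPlaces_eq_union]; exact Finset.subset_union_left

theorem IsWord.le_least_excLetters (hw : IsWord m w) (hr : r ≤ m) (a : ℕ) :
    r ≤ least (excLetters r m w) (m + 1) a := by
  rcases least_mem (excLetters r m w) (m + 1) a with h | h
  · omega
  · exact (hw.excLetters_bounds h.1).1

theorem IsWord.one_le_least (hw : IsWord m w) (a : ℕ) :
    1 ≤ least (excLetters r m w) (m + 1) a := by
  rcases least_mem (excLetters r m w) (m + 1) a with h | h
  · omega
  · exact (hw.excLetters_bounds h.1).2.1.le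

theorem IsWord.alphaInsert (hw : IsWord m w) (hr : r ≤ m) (hx : x ∈ setA r m w) :
    IsWord (m + 1) (alphaInsert r m x w) :=
  (placeMap_pushPlace hx setA_bounds hr).isWord_insertLetter hw (hw.one_le_least 0) least_le_right
    up_bounds fun _ _ _ hk _ hl => up_inj hk hl

/-- A letter pushed along `𝒜` was already `≥ r` and is raised strictly, so it is an excedance even
at place `r`. Beyond `r` raising compensates the shift, as in Han's insertion. -/
theorem IsWord.excTransfer_alphaInsert (hw : IsWord m w) (hr : r ≤ m) (hx : x ∈ setA r m w) :
    ExcTransfer r m x (pushPlace (setA r m w) r x) w (RDenert.alphaInsert r m x w) := by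
  have hq := placeMap_pushPlace hx setA_bounds hr
  refine ⟨hq, fun i hi1 hi2 hix => ?_⟩
  have hb := hq.maps hi1 hi2 hix
  have hE := hw.mem_excLetters (r := r) hb.1 hb.2
  have hle := hw.le hb.1 hb.2
  rw [mem_excPlaces, alphaInsert_of_ne hix]
  by_cases hi : i ∈ setA r m w ∨ i = r
  · have h := setA_subset_excPlaces (pushPlace_mem hx setA_bounds hi hix).1
    have h1 := lt_up (a := 0) (hE.2 h) (Nat.zero_le _) hle
    have h2 := mem_excPlaces.1 h
    refine ⟨fun _ => h, fun _ => ⟨⟨hi1, hi2⟩, ?_, by omega⟩⟩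
    rcases hi with hi | hi
    · have := (setA_bounds i hi).2
      omega
    · omega
  · push Not at hi
    rcases lt_or_gt_of_ne hi.2 with h | h
    · have h3 := hi.1
      rw [mem_setA] at h3
      rw [pushPlace_of_notMem h hi.1, up_of_not (by
        intro h'
        have := hw.excLetters_bounds h'.1
        omega), mem_excPlaces]
      omega
    · rw [pushPlace_of_gt h] at *
      by_cases hexc : i - 1 ∈ excPlaces r m w
      · have h1 := lt_up (a := 0) (hE.2 hexc) (Nat.zero_le _) hle
        have h2 := mem_excPlaces.1 hexc
        exact ⟨fun _ => hexc, fun _ => ⟨⟨hi1, hi2⟩, by omega, by omega⟩⟩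
      · rw [up_of_not fun h => hexc (hE.1 h.1)]
        rw [mem_excPlaces] at hexc ⊢
        omega

theorem IsWord.mem_exc_alphaInsert (hw : IsWord m w) (hr : r ≤ m) (hx : x ∈ setA r m w) (i : ℕ) :
    i ∈ excPlaces r (m + 1) (RDenert.alphaInsert r m x w) ↔
      i ∈ setA r m w ∨ i = r ∨ ∃ j ∈ highPlaces r m w, j + 1 = i := by
  have h := hw.excTransfer_alphaInsert hr hx
  have hxr := setA_bounds x hx
  by_cases hix : i = x
  · subst hix
    have := hw.le_least_excLetters hr 0
    rw [mem_excPlaces, alphaInsert_self]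
    exact ⟨fun _ => Or.inl hx, fun _ => ⟨⟨hxr.1, by omega⟩, by omega, this⟩⟩
  by_cases hi : i ∈ setA r m w ∨ i = r
  · have h1 : 1 ≤ i ∧ i ≤ m + 1 := by
      rcases hi with hi | hi
      · have := setA_bounds i hi
        omega
      · omega
    rw [h.exc_iff i h1.1 h1.2 hix]
    have := setA_subset_excPlaces (pushPlace_mem hx setA_bounds hi hix).1
    tauto
  · have hi' := hi
    push Not at hi'
    constructor
    · intro hexc
      have h1 := (mem_excPlaces.1 hexc).1
      rw [h.exc_iff i h1.1 h1.2 hix] at hexc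
      rcases lt_or_gt_of_ne hi'.2 with h2 | h2
      · rw [pushPlace_of_notMem h2 hi'.1, mem_excPlaces] at hexc
        exact absurd (mem_setA.2 ⟨hexc.1, hexc.2.2, h2⟩) hi'.1
      · rw [pushPlace_of_gt h2, mem_excPlaces] at hexc
        exact Or.inr (Or.inr ⟨i - 1, mem_highPlaces.2 ⟨hexc.1, hexc.2.1, by omega⟩, by omega⟩)
    · rintro (h1 | h1 | ⟨j, hj, rfl⟩)
      · exact absurd h1 hi'.1
      · exact absurd h1 hi'.2
      · rw [mem_highPlaces] at hj
        rw [h.exc_iff _ (by omega) (by omega) hix, pushPlace_of_gt (by omega), mem_excPlaces]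
        simp only [Nat.add_sub_cancel]
        omega

theorem IsWord.highPlaces_alphaInsert (hw : IsWord m w) (hrm : r ≤ m)
    (hx : x ∈ setA r m w) : highPlaces r (m + 1) (RDenert.alphaInsert r m x w) =
      insert r ((highPlaces r m w).image (· + 1)) := by
  ext i
  have h := hw.mem_exc_alphaInsert hrm hx i
  rw [Finset.mem_insert, Finset.mem_image]
  constructor
  · intro hi
    rw [mem_highPlaces] at hi
    rw [mem_excPlaces] at h
    rcases h.1 ⟨hi.1, hi.2.1, by omega⟩ with h1 | h1 | h1
    · have := setA_bounds i h1
      omega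
    · exact Or.inl h1
    · exact Or.inr h1
  · intro hi
    have h1 := h.2 (Or.inr hi)
    rw [mem_excPlaces] at h1
    rw [mem_highPlaces]
    refine ⟨h1.1, h1.2.1, ?_⟩
    rcases hi with hi | ⟨j, hj, rfl⟩
    · exact hi.ge
    · rw [mem_highPlaces] at hj
      omega

theorem IsWord.setA_alphaInsert (hw : IsWord m w) (hrm : r ≤ m)
    (hx : x ∈ setA r m w) : setA r (m + 1) (RDenert.alphaInsert r m x w) = setA r m w := by
  ext i
  have h := hw.mem_exc_alphaInsert hrm hx i
  constructor
  · intro hi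
    have hi' := mem_setA.1 hi
    rcases h.1 (setA_subset_excPlaces hi) with h1 | h1 | ⟨j, h1, rfl⟩
    · exact h1
    · omega
    · rw [mem_highPlaces] at h1
      omega
  · intro hi
    have h1 := mem_excPlaces.1 (h.2 (Or.inl hi))
    rw [mem_setA]
    exact ⟨h1.1, h1.2.2, (setA_bounds i hi).2⟩

theorem sum_image_succ (S : Finset ℕ) : ∑ i ∈ S.image (· + 1), i = ∑ i ∈ S, i + S.card := by
  rw [Finset.sum_image fun i _ j _ h => add_left_injective 1 h, Finset.sum_add_distrib]
  simp

theorem card_image_succ (S : Finset ℕ) : (S.image (· + 1)).card = S.card :=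
  Finset.card_image_of_injective _ Nat.succ_injective

theorem notMem_image_succ_highPlaces : r ∉ (highPlaces r m w).image (· + 1) := by
  intro h
  obtain ⟨j, hj, e⟩ := Finset.mem_image.1 h
  rw [mem_highPlaces] at hj
  omega

theorem IsWord.exc_alphaInsert (hw : IsWord m w) (hrm : r ≤ m)
    (hx : x ∈ setA r m w) : exc r (m + 1) (RDenert.alphaInsert r m x w) = exc r m w + 1 := by
  rw [exc_eq_card, hw.highPlaces_alphaInsert hrm hx,
    Finset.card_insert_of_notMem notMem_image_succ_highPlaces, card_image_succ, exc_eq_card]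

theorem sum_excPlaces : ∑ i ∈ excPlaces r m w, i =
    ∑ i ∈ setA r m w, i + ∑ i ∈ highPlaces r m w, i := by
  rw [excPlaces_eq_union, Finset.sum_union disjoint_setA_highPlaces]

/-- The sum of places grows by `r + exc`. The new letter is below all other excedance letters, hence
inverted with the excedance places left of `x` and no others; these lie in `𝒜`. -/
theorem IsWord.den_alphaInsert (hw : IsWord m w) (hrm : r ≤ m)
    (hx : x ∈ setA r m w) : den r (m + 1) (RDenert.alphaInsert r m x w) =
      den r m w + (exc r m w + r + ((setA r m w).filter fun j => j < x).card) := by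
  have h := hw.excTransfer_alphaInsert hrm hx
  have hexc := hw.mem_exc_alphaInsert hrm hx
  have e0 : ∑ i ∈ excPlaces r (m + 1) (RDenert.alphaInsert r m x w), i =
      ∑ i ∈ excPlaces r m w, i + (r + exc r m w) := by
    rw [sum_excPlaces, hw.setA_alphaInsert hrm hx, hw.highPlaces_alphaInsert hrm hx,
      Finset.sum_insert notMem_image_succ_highPlaces, sum_image_succ, sum_excPlaces, exc_eq_card]
    omega
  have hmem : x ∈ excPlaces r (m + 1) (RDenert.alphaInsert r m x w) := (hexc x).2 (Or.inl hx)
  have hnot : x ∉ nonexcPlaces r (m + 1) (RDenert.alphaInsert r m x w) := fun h' =>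
    (mem_nonexcPlaces.1 h').2 hmem
  have hside : ∀ i ∈ excPlaces r (m + 1) (RDenert.alphaInsert r m x w),
      i ∈ setA r m w ∨ r ≤ i := by
    intro i hi
    rcases (hexc i).1 hi with h1 | h1 | ⟨j, h1, rfl⟩
    · exact Or.inl h1
    · exact Or.inr h1.ge
    · rw [mem_highPlaces] at h1
      exact Or.inr (by omega)
  have hlet : ∀ i ∈ excPlaces r (m + 1) (RDenert.alphaInsert r m x w), i ≠ x →
      w (pushPlace (setA r m w) r x i) ∈ excLetters r m w ∧
        w (pushPlace (setA r m w) r x i) ≤ m := by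
    intro i hi hix
    have a := (mem_excPlaces.1 hi).1
    have a' := h.maps a.1 a.2 hix
    exact ⟨(hw.mem_excLetters a'.1 a'.2).2 ((h.exc_iff i a.1 a.2 hix).1 hi), hw.le a'.1 a'.2⟩
  have e2 : inv ((excPlaces r (m + 1) (RDenert.alphaInsert r m x w)).erase x)
      (RDenert.alphaInsert r m x w) = inv (excPlaces r m w) w := by
    refine h.inv_erase excPlaces_subset excPlaces_subset h.exc_iff
      (fun i hi j hj hix hjx hij => pushPlace_lt_pushPlace hx setA_bounds (hside i hi) (hside j hj)
        hix hjx hij) fun i hi j hj hix hjx => ?_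
    rw [alphaInsert_of_ne hix, alphaInsert_of_ne hjx]
    exact up_lt_up_iff (hlet j hj hjx).1 (hlet i hi hix).1 (hlet j hj hjx).2 (hlet i hi hix).2
  have hlt : ∀ i ∈ excPlaces r (m + 1) (RDenert.alphaInsert r m x w), i ≠ x →
      RDenert.alphaInsert r m x w x < RDenert.alphaInsert r m x w i := by
    intro i hi hix
    rw [alphaInsert_self, alphaInsert_of_ne hix]
    exact least_lt_up (hlet i hi hix).1 (Nat.zero_le _) (hlet i hi hix).2
  have e3 : inv ((nonexcPlaces r (m + 1) (RDenert.alphaInsert r m x w)).erase x)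
      (RDenert.alphaInsert r m x w) = inv (nonexcPlaces r m w) w := by
    have hn : ∀ i ∈ nonexcPlaces r (m + 1) (RDenert.alphaInsert r m x w),
        i ∉ setA r m w ∧ i ≠ r := by
      intro i hi
      rw [mem_nonexcPlaces, hexc] at hi
      tauto
    refine h.inv_nonexc (fun i hi j hj _ _ hij => pushPlace_lt_pushPlace' (hn i hi).1 (hn j hj).1
      (hn i hi).2 (hn j hj).2 hij) fun i hi hix => ?_
    have a := (mem_nonexcPlaces.1 hi).1
    have a' := h.maps a.1 a.2 hix
    rw [h.nonexc_iff i a.1 a.2 hix, mem_nonexcPlaces] at hi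
    rw [alphaInsert_of_ne hix, up_of_not]
    exact fun h' => hi.2 ((hw.mem_excLetters a'.1 a'.2).1 h'.1)
  rw [Finset.erase_eq_of_notMem hnot] at e3
  have e4 := inv_insert (w := RDenert.alphaInsert r m x w)
    (Finset.notMem_erase x (excPlaces r (m + 1) (RDenert.alphaInsert r m x w)))
  rw [Finset.insert_erase hmem, e2] at e4
  have e5 : (((excPlaces r (m + 1) (RDenert.alphaInsert r m x w)).erase x).filter
      fun i => x < i ∧ RDenert.alphaInsert r m x w i < RDenert.alphaInsert r m x w x) = ∅ := by
    apply Finset.filter_false_of_mem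
    rintro i hi ⟨-, h2⟩
    rw [Finset.mem_erase] at hi
    exact h2.asymm (hlt i hi.2 hi.1)
  have e6 : (((excPlaces r (m + 1) (RDenert.alphaInsert r m x w)).erase x).filter
      fun i => i < x ∧ RDenert.alphaInsert r m x w x < RDenert.alphaInsert r m x w i) =
      (setA r m w).filter fun j => j < x := by
    ext i
    have hxr := (setA_bounds x hx).2
    rw [Finset.mem_filter, Finset.mem_erase, Finset.mem_filter]
    constructor
    · rintro ⟨⟨_, a⟩, b, _⟩
      exact ⟨(hside i a).resolve_right (by omega), b⟩
    · rintro ⟨a, b⟩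
      have := (hexc i).2 (Or.inl a)
      exact ⟨⟨b.ne, this⟩, b, hlt i this b.ne⟩
  rw [e5, e6, Finset.card_empty] at e4
  unfold den
  omega

end Alpha

/-! ### Insertion at a place of `ℬ` -/

/-- Only the minimum of `F` changes its position in the order, so an element `j` below both
witnesses that neither letter is the minimum. -/
theorem rot_lt_rot_iff {F : Finset ℕ} {j k l : ℕ} (hj : j ∈ F) (hk : k ∈ F) (hl : l ∈ F)
    (hjk : j < k) (hjl : j < l) : rot F k < rot F l ↔ k < l := by
  constructor
  · intro h
    by_contra hc
    rcases (not_lt.1 hc).eq_or_lt with rfl | hlt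
    · exact lt_irrefl _ h
    · exact lt_asymm h (rot_lt_rot hj hl hk hjl hlt)
  · exact fun h => rot_lt_rot hj hk hl hjk h

section Beta
variable {r m x : ℕ} {w : ℕ → ℕ}

/-- The insertion at a place `x` of `ℬ`, before the rotation of letters. -/
def betaPush (r m x : ℕ) (w : ℕ → ℕ) : ℕ → ℕ :=
  insertLetter x (least (excLetters r m w) (m + 1) 0) (pushPlace (setB r m w) r x)
    (up (excLetters r m w) (m + 1) 0) w

/-- The letters that are rotated in the insertion at a place `x` of `ℬ`. -/
def rotLetters (r m x : ℕ) (w : ℕ → ℕ) : Finset ℕ :=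
  (insert x (setA r m w)).image (betaPush r m x w)

/-- The insertion at a place `x` of `ℬ`. -/
def betaInsert (r m x : ℕ) (w : ℕ → ℕ) (i : ℕ) : ℕ := rot (rotLetters r m x w) (betaPush r m x w i)

theorem betaPush_self : betaPush r m x w x = least (excLetters r m w) (m + 1) 0 :=
  insertLetter_self

theorem betaPush_of_ne {i : ℕ} (h : i ≠ x) : betaPush r m x w i =
    up (excLetters r m w) (m + 1) 0 (w (pushPlace (setB r m w) r x i)) :=
  insertLetter_of_ne h

theorem IsWord.betaPush (hw : IsWord m w) (hr : r ≤ m) (hx : x ∈ setB r m w) :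
    IsWord (m + 1) (betaPush r m x w) :=
  (placeMap_pushPlace hx setB_bounds hr).isWord_insertLetter hw (hw.one_le_least 0) least_le_right
    up_bounds fun _ _ _ hk _ hl => up_inj hk hl

/-- Letters pushed along `ℬ` are below `r`, so they are not excedances before or after; the places
of `𝒜` do not move. -/
theorem IsWord.excTransfer_betaPush (hw : IsWord m w) (hr : r ≤ m) (hx : x ∈ setB r m w) :
    ExcTransfer r m x (pushPlace (setB r m w) r x) w (RDenert.betaPush r m x w) := by
  have hq := placeMap_pushPlace hx setB_bounds hr
  refine ⟨hq, fun i hi1 hi2 hix => ?_⟩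
  have hb := hq.maps hi1 hi2 hix
  have hE := hw.mem_excLetters (r := r) hb.1 hb.2
  have hle := hw.le hb.1 hb.2
  rw [mem_excPlaces, betaPush_of_ne hix]
  by_cases hi : i ∈ setB r m w ∨ i = r
  · have h := mem_setB.1 (pushPlace_mem hx setB_bounds hi hix).1
    rw [up_of_not (by
      intro h'
      have := hw.excLetters_bounds h'.1
      omega), mem_excPlaces]
    omega
  · push Not at hi
    rcases lt_or_gt_of_ne hi.2 with h | h
    · have h3 := hi.1
      rw [mem_setB] at h3
      rw [pushPlace_of_notMem h hi.1] at *
      have h4 := le_up (E := excLetters r m w) (a := 0) hle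
      rw [mem_excPlaces]
      omega
    · rw [pushPlace_of_gt h] at *
      by_cases hexc : i - 1 ∈ excPlaces r m w
      · have h1 := lt_up (a := 0) (hE.2 hexc) (Nat.zero_le _) hle
        have h2 := mem_excPlaces.1 hexc
        exact ⟨fun _ => hexc, fun _ => ⟨⟨hi1, hi2⟩, by omega, by omega⟩⟩
      · rw [up_of_not fun h => hexc (hE.1 h.1)]
        rw [mem_excPlaces] at hexc ⊢
        omega

theorem IsWord.mem_exc_betaPush (hw : IsWord m w) (hr : r ≤ m) (hx : x ∈ setB r m w) (i : ℕ) :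
    i ∈ excPlaces r (m + 1) (RDenert.betaPush r m x w) ↔
      i ∈ insert x (setA r m w) ∨ i ∈ (highPlaces r m w).image (· + 1) := by
  have h := hw.excTransfer_betaPush hr hx
  have hxr := setB_bounds x hx
  rw [Finset.mem_insert, Finset.mem_image]
  by_cases hix : i = x
  · subst hix
    have := hw.le_least_excLetters hr 0
    rw [mem_excPlaces, betaPush_self]
    exact ⟨fun _ => Or.inl (Or.inl rfl), fun _ => ⟨⟨hxr.1, by omega⟩, by omega, this⟩⟩
  constructor
  · intro hexc
    have h1 := (mem_excPlaces.1 hexc).1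
    rw [h.exc_iff i h1.1 h1.2 hix] at hexc
    have h3 : ¬ (i ∈ setB r m w ∨ i = r) := fun h' => by
      have h4 := mem_setB.1 (pushPlace_mem hx setB_bounds h' hix).1
      rw [mem_excPlaces] at hexc
      omega
    push Not at h3
    rcases lt_or_gt_of_ne h3.2 with h2 | h2
    · rw [pushPlace_of_notMem h2 h3.1, mem_excPlaces] at hexc
      exact Or.inl (Or.inr (mem_setA.2 ⟨hexc.1, hexc.2.2, h2⟩))
    · rw [pushPlace_of_gt h2, mem_excPlaces] at hexc
      exact Or.inr ⟨i - 1, mem_highPlaces.2 ⟨hexc.1, hexc.2.1, by omega⟩, by omega⟩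
  · rintro ((h1 | h1) | ⟨j, hj, rfl⟩)
    · exact absurd h1 hix
    · have h2 := mem_setA.1 h1
      rw [h.exc_iff _ (by omega) (by omega) hix, pushPlace_of_notMem h2.2.2
        (fun h' => by rw [mem_setB] at h'; omega)]
      exact setA_subset_excPlaces h1
    · rw [mem_highPlaces] at hj
      rw [h.exc_iff _ (by omega) (by omega) hix, pushPlace_of_gt (by omega), mem_excPlaces]
      simp only [Nat.add_sub_cancel]
      omega

theorem insert_setA_bounds (hx : x ∈ setB r m w) :
    ∀ i ∈ insert x (setA r m w), 1 ≤ i ∧ i ≤ m + 1 ∧ i < r := by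
  intro i hi
  rw [mem_setB] at hx
  rw [Finset.mem_insert, mem_setA] at hi
  omega

theorem IsWord.filter_exc_betaPush (hw : IsWord m w) (hr : r ≤ m) (hx : x ∈ setB r m w) :
    (excPlaces r (m + 1) (RDenert.betaPush r m x w)).filter (fun i => i < r) =
      insert x (setA r m w) := by
  ext i
  rw [Finset.mem_filter, hw.mem_exc_betaPush hr hx]
  constructor
  · rintro ⟨h | h, h'⟩
    · exact h
    · obtain ⟨j, hj, rfl⟩ := Finset.mem_image.1 h
      rw [mem_highPlaces] at hj
      omega
  · exact fun h => ⟨Or.inl h, (insert_setA_bounds hx i h).2.2⟩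

theorem IsWord.le_rotLetters (hw : IsWord m w) (hr : r ≤ m) (hx : x ∈ setB r m w) {f : ℕ}
    (hf : f ∈ rotLetters r m x w) : r ≤ f := by
  obtain ⟨i, hi, rfl⟩ := Finset.mem_image.1 hf
  exact (mem_excPlaces.1 ((hw.mem_exc_betaPush hr hx i).2 (Or.inl hi))).2.2

theorem IsWord.betaPush_mem_rotLetters (hw : IsWord m w) (hr : r ≤ m) (hx : x ∈ setB r m w)
    {i : ℕ} (h1 : 1 ≤ i) (h2 : i ≤ m + 1) :
    RDenert.betaPush r m x w i ∈ rotLetters r m x w ↔ i ∈ insert x (setA r m w) := by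
  constructor
  · intro h
    obtain ⟨j, hj, e⟩ := Finset.mem_image.1 h
    have := insert_setA_bounds hx j hj
    rwa [← (hw.betaPush hr hx).inj this.1 this.2.1 h1 h2 e]
  · exact fun h => Finset.mem_image_of_mem _ h

theorem IsWord.betaInsert_of_notMem (hw : IsWord m w) (hr : r ≤ m) (hx : x ∈ setB r m w)
    {i : ℕ} (h1 : 1 ≤ i) (h2 : i ≤ m + 1) (hi : i ∉ insert x (setA r m w)) :
    betaInsert r m x w i = RDenert.betaPush r m x w i :=
  rot_of_notMem fun h => hi ((hw.betaPush_mem_rotLetters hr hx h1 h2).1 h)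

theorem IsWord.betaInsert (hw : IsWord m w) (hr : r ≤ m) (hx : x ∈ setB r m w) :
    IsWord (m + 1) (betaInsert r m x w) := by
  have h := hw.betaPush hr hx
  have key : ∀ {i}, 1 ≤ i → i ≤ m + 1 →
      1 ≤ RDenert.betaInsert r m x w i ∧ RDenert.betaInsert r m x w i ≤ m + 1 := by
    intro i h1 h2
    by_cases hi : i ∈ insert x (setA r m w)
    · have h3 := rot_mem ((hw.betaPush_mem_rotLetters hr hx h1 h2).2 hi)
      obtain ⟨j, hj, e⟩ := Finset.mem_image.1 h3
      have := insert_setA_bounds hx j hj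
      rw [RDenert.betaInsert, ← e]
      exact ⟨h.pos this.1 this.2.1, h.le this.1 this.2.1⟩
    · rw [hw.betaInsert_of_notMem hr hx h1 h2 hi]
      exact ⟨h.pos h1 h2, h.le h1 h2⟩
  exact ⟨fun h1 h2 => (key h1 h2).1, fun h1 h2 => (key h1 h2).2,
    fun h1 h2 h3 h4 e => h.inj h1 h2 h3 h4 (rot_inj e)⟩

theorem IsWord.excPlaces_betaInsert (hw : IsWord m w) (hr : r ≤ m) (hx : x ∈ setB r m w) :
    excPlaces r (m + 1) (RDenert.betaInsert r m x w) =
      insert x (setA r m w) ∪ (highPlaces r m w).image (· + 1) := by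
  ext i
  rw [Finset.mem_union]
  by_cases hi : i ∈ insert x (setA r m w)
  · refine ⟨fun _ => Or.inl hi, fun _ => ?_⟩
    have h := insert_setA_bounds hx i hi
    have h1 := hw.le_rotLetters hr hx
      (rot_mem ((hw.betaPush_mem_rotLetters hr hx h.1 h.2.1).2 hi))
    rw [mem_excPlaces]
    exact ⟨⟨h.1, h.2.1⟩, h.2.2.trans_le h1, h1⟩
  · rw [← hw.mem_exc_betaPush hr hx, mem_excPlaces, mem_excPlaces]
    constructor <;>
    · rintro ⟨h1, h2⟩
      rw [hw.betaInsert_of_notMem hr hx h1.1 h1.2 hi] at *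
      exact ⟨h1, h2⟩

/-- The rotation permutes letters `≥ r` among places `< r`, so all these places remain excedance
places. -/
theorem IsWord.excTransfer_betaInsert (hw : IsWord m w) (hr : r ≤ m) (hx : x ∈ setB r m w) :
    ExcTransfer r m x (pushPlace (setB r m w) r x) w (RDenert.betaInsert r m x w) := by
  have h := hw.excTransfer_betaPush hr hx
  refine ⟨h.toPlaceMap, fun i hi1 hi2 hix => ?_⟩
  rw [hw.excPlaces_betaInsert hr hx, ← h.exc_iff i hi1 hi2 hix, hw.mem_exc_betaPush hr hx,
    Finset.mem_union]

theorem IsWord.setA_betaInsert (hw : IsWord m w) (hr : r ≤ m) (hx : x ∈ setB r m w) :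
    setA r (m + 1) (RDenert.betaInsert r m x w) = insert x (setA r m w) := by
  ext i
  have h := Finset.ext_iff.1 (hw.excPlaces_betaInsert hr hx) i
  rw [Finset.mem_union] at h
  constructor
  · intro hi
    rcases h.1 (setA_subset_excPlaces hi) with h1 | h1
    · exact h1
    · obtain ⟨j, hj, rfl⟩ := Finset.mem_image.1 h1
      rw [mem_highPlaces] at hj
      rw [mem_setA] at hi
      omega
  · intro hi
    have h1 := mem_excPlaces.1 (h.2 (Or.inl hi))
    exact mem_setA.2 ⟨h1.1, h1.2.2, (insert_setA_bounds hx i hi).2.2⟩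

theorem IsWord.highPlaces_betaInsert (hw : IsWord m w) (hr : r ≤ m) (hx : x ∈ setB r m w) :
    highPlaces r (m + 1) (RDenert.betaInsert r m x w) = (highPlaces r m w).image (· + 1) := by
  ext i
  have h := Finset.ext_iff.1 (hw.excPlaces_betaInsert hr hx) i
  rw [Finset.mem_union] at h
  constructor
  · intro hi
    rw [mem_highPlaces] at hi
    rcases h.1 (mem_excPlaces.2 ⟨hi.1, hi.2.1, by omega⟩) with h1 | h1
    · have := insert_setA_bounds hx i h1
      omega
    · exact h1
  · intro hi
    have h1 := mem_excPlaces.1 (h.2 (Or.inr hi))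
    rw [mem_highPlaces]
    refine ⟨h1.1, h1.2.1, ?_⟩
    obtain ⟨j, hj, rfl⟩ := Finset.mem_image.1 hi
    rw [mem_highPlaces] at hj
    omega

theorem IsWord.exc_betaInsert (hw : IsWord m w) (hr : r ≤ m) (hx : x ∈ setB r m w) :
    exc r (m + 1) (RDenert.betaInsert r m x w) = exc r m w := by
  rw [exc_eq_card, hw.highPlaces_betaInsert hr hx, card_image_succ, exc_eq_card]

theorem notMem_setA_of_setB (hx : x ∈ setB r m w) : x ∉ setA r m w := by
  rw [mem_setB] at hx
  rw [mem_setA]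
  omega

theorem betaPush_of_mem_setA (hx : x ∈ setB r m w) {i : ℕ} (hi : i ∈ setA r m w) :
    betaPush r m x w i = up (excLetters r m w) (m + 1) 0 (w i) := by
  have h := mem_setA.1 hi
  have hix : i ≠ x := fun h' => notMem_setA_of_setB hx (h' ▸ hi)
  rw [betaPush_of_ne hix, pushPlace_of_notMem h.2.2]
  exact fun h' => notMem_setA_of_setB h' hi

theorem IsWord.mem_excLetters_of_setA (hw : IsWord m w) {i : ℕ} (hi : i ∈ setA r m w) :
    w i ∈ excLetters r m w ∧ w i ≤ m := by
  have h := mem_setA.1 hi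
  exact ⟨(hw.mem_excLetters h.1.1 h.1.2).2 (setA_subset_excPlaces hi), hw.le h.1.1 h.1.2⟩

theorem highPlaces_subset_excPlaces : highPlaces r m w ⊆ excPlaces r m w := by
  rw [excPlaces_eq_union]; exact Finset.subset_union_right

theorem IsWord.mem_excLetters_of_highPlaces (hw : IsWord m w) {i : ℕ}
    (hi : i ∈ highPlaces r m w) : w i ∈ excLetters r m w ∧ w i ≤ m := by
  have h := mem_highPlaces.1 hi
  exact ⟨(hw.mem_excLetters h.1.1 h.1.2).2 (highPlaces_subset_excPlaces hi), hw.le h.1.1 h.1.2⟩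

theorem rotLetters_eq (hx : x ∈ setB r m w) : rotLetters r m x w =
    insert (least (excLetters r m w) (m + 1) 0)
      (((setA r m w).image w).image (up (excLetters r m w) (m + 1) 0)) := by
  rw [rotLetters, Finset.image_insert, betaPush_self, Finset.image_image]
  congr 1
  apply Finset.image_congr
  intro i hi
  exact betaPush_of_mem_setA hx hi

theorem IsWord.betaInsert_succ (hw : IsWord m w) (hr : r ≤ m) (hx : x ∈ setB r m w) {j : ℕ}
    (hj : j ∈ highPlaces r m w) :
    RDenert.betaInsert r m x w (j + 1) = up (excLetters r m w) (m + 1) 0 (w j) := by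
  have h := mem_highPlaces.1 hj
  have hxr := setB_bounds x hx
  rw [hw.betaInsert_of_notMem hr hx (by omega) (by omega), betaPush_of_ne (by omega),
    pushPlace_of_gt (by omega), Nat.add_sub_cancel]
  intro h'
  have := insert_setA_bounds hx _ h'
  omega

theorem IsWord.betaInsert_self (hw : IsWord m w) (hx : x ∈ setB r m w) :
    RDenert.betaInsert r m x w x = (rotLetters r m x w).sup id := by
  rw [RDenert.betaInsert, betaPush_self, rot_of_min]
  · rw [rotLetters_eq hx]; exact Finset.mem_insert_self _ _
  · intro k hk
    rw [rotLetters_eq hx, Finset.mem_insert, Finset.mem_image] at hk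
    rcases hk with rfl | ⟨l, hl, rfl⟩
    · exact le_rfl
    · obtain ⟨i, hi, rfl⟩ := Finset.mem_image.1 hl
      have := hw.mem_excLetters_of_setA hi
      exact (least_lt_up this.1 (Nat.zero_le _) this.2).le

/-- Before the rotation the letter at `x` is the smallest of the low excedance letters; afterwards
it is the largest. So it is inverted with every place of `𝒜` to its right and none to its left,
while the others keep their relative order. -/
theorem IsWord.inv_insert_setA_betaInsert (hw : IsWord m w) (hx : x ∈ setB r m w) :
    inv (insert x (setA r m w)) (RDenert.betaInsert r m x w) =
      inv (setA r m w) w + ((setA r m w).filter fun j => x < j).card := by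
  have hmin : least (excLetters r m w) (m + 1) 0 ∈ rotLetters r m x w := by
    rw [rotLetters_eq hx]; exact Finset.mem_insert_self _ _
  have hA : ∀ i ∈ setA r m w,
      up (excLetters r m w) (m + 1) 0 (w i) ∈ rotLetters r m x w ∧
      least (excLetters r m w) (m + 1) 0 < up (excLetters r m w) (m + 1) 0 (w i) ∧
      RDenert.betaInsert r m x w i =
        rot (rotLetters r m x w) (up (excLetters r m w) (m + 1) 0 (w i)) := by
    intro i hi
    have := hw.mem_excLetters_of_setA hi
    refine ⟨?_, least_lt_up this.1 (Nat.zero_le _) this.2, ?_⟩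
    · rw [rotLetters_eq hx]
      exact Finset.mem_insert_of_mem (Finset.mem_image_of_mem _ (Finset.mem_image_of_mem _ hi))
    · rw [RDenert.betaInsert, betaPush_of_mem_setA hx hi]
  have hlt : ∀ i ∈ setA r m w, RDenert.betaInsert r m x w i < RDenert.betaInsert r m x w x := by
    intro i hi
    obtain ⟨h1, h2, h3⟩ := hA i hi
    rw [h3, hw.betaInsert_self hx]
    exact rot_lt_sup hmin h1 h2
  rw [inv_insert (notMem_setA_of_setB hx)]
  have e1 : ((setA r m w).filter fun i => i < x ∧
      RDenert.betaInsert r m x w x < RDenert.betaInsert r m x w i) = ∅ :=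
    Finset.filter_false_of_mem fun i hi h => h.2.asymm (hlt i hi)
  have e2 : ((setA r m w).filter fun i => x < i ∧
      RDenert.betaInsert r m x w i < RDenert.betaInsert r m x w x) =
      (setA r m w).filter fun i => x < i :=
    Finset.filter_congr fun i hi => ⟨And.left, fun h => ⟨h, hlt i hi⟩⟩
  have e3 : inv (setA r m w) (RDenert.betaInsert r m x w) = inv (setA r m w) w := by
    refine inv_congr (q := id) (fun i hi => hi) (fun i _ j _ h => h) (fun k hk => ⟨k, hk, rfl⟩)
      fun i hi j hj _ => ?_
    obtain ⟨h1, h2, h3⟩ := hA i hi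
    obtain ⟨h4, h5, h6⟩ := hA j hj
    have h7 := hw.mem_excLetters_of_setA hi
    have h8 := hw.mem_excLetters_of_setA hj
    rw [h3, h6, rot_lt_rot_iff hmin h4 h1 h5 h2, up_lt_up_iff h8.1 h7.1 h8.2 h7.2]
    rfl
  rw [e1, e2, e3, Finset.card_empty, add_zero]

theorem IsWord.inv_high_betaInsert (hw : IsWord m w) (hr : r ≤ m) (hx : x ∈ setB r m w) :
    inv ((highPlaces r m w).image (· + 1)) (RDenert.betaInsert r m x w) =
      inv (highPlaces r m w) w := by
  refine inv_congr (q := fun i => i - 1) ?_ ?_ ?_ ?_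
  · intro i hi
    obtain ⟨j, hj, rfl⟩ := Finset.mem_image.1 hi
    exact hj
  · intro i hi j hj hij
    obtain ⟨i, -, rfl⟩ := Finset.mem_image.1 hi
    obtain ⟨j, -, rfl⟩ := Finset.mem_image.1 hj
    simpa using hij
  · exact fun k hk => ⟨k + 1, Finset.mem_image_of_mem _ hk, rfl⟩
  · intro i hi j hj hij
    obtain ⟨i, hi', rfl⟩ := Finset.mem_image.1 hi
    obtain ⟨j, hj', rfl⟩ := Finset.mem_image.1 hj
    have h7 := hw.mem_excLetters_of_highPlaces hi'
    have h8 := hw.mem_excLetters_of_highPlaces hj'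
    simp only [Nat.add_sub_cancel]
    rw [hw.betaInsert_succ hr hx hi', hw.betaInsert_succ hr hx hj',
      up_lt_up_iff h8.1 h7.1 h8.2 h7.2]

theorem image_betaInsert :
    (insert x (setA r m w)).image (betaInsert r m x w) = rotLetters r m x w := by
  conv_rhs => rw [← image_rot (F := rotLetters r m x w)]
  nth_rw 2 [rotLetters]
  rw [Finset.image_image]
  rfl

/-- The inversions between low and high excedance places depend only on the set of low letters,
which the rotation preserves. The extra low letter `e_1` is below every high letter and contributes
nothing. -/
theorem IsWord.card_cross_betaInsert (hw : IsWord m w) (hr : r ≤ m) (hx : x ∈ setB r m w) {j : ℕ}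
    (hj : j ∈ highPlaces r m w) :
    (((insert x (setA r m w)).image (RDenert.betaInsert r m x w)).filter
      fun a => RDenert.betaInsert r m x w (j + 1) < a).card =
      (((setA r m w).image w).filter fun a => w j < a).card := by
  have h7 := hw.mem_excLetters_of_highPlaces hj
  have hA : ∀ a ∈ (setA r m w).image w, a ∈ excLetters r m w ∧ a ≤ m := by
    intro a ha
    obtain ⟨i, hi, rfl⟩ := Finset.mem_image.1 ha
    exact hw.mem_excLetters_of_setA hi
  rw [image_betaInsert, rotLetters_eq hx, hw.betaInsert_succ hr hx hj, Finset.filter_insert,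
    if_neg (least_lt_up h7.1 (Nat.zero_le _) h7.2).asymm, Finset.filter_image,
    Finset.card_image_of_injOn]
  · congr 1
    apply Finset.filter_congr
    intro a ha
    exact up_lt_up_iff h7.1 (hA a ha).1 h7.2 (hA a ha).2
  · intro a ha b hb h
    exact up_inj (hA a (Finset.mem_filter.1 ha).1).2 (hA b (Finset.mem_filter.1 hb).1).2 h

/-- Low places are split from high ones because the rotation does not respect the order between low
and high letters place by place, only the total number of cross inversions. -/
theorem IsWord.inv_exc_betaInsert (hw : IsWord m w) (hr : r ≤ m) (hx : x ∈ setB r m w) :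
    inv (excPlaces r (m + 1) (RDenert.betaInsert r m x w)) (RDenert.betaInsert r m x w) =
      inv (excPlaces r m w) w + ((setA r m w).filter fun j => x < j).card := by
  have hb := insert_setA_bounds hx
  rw [hw.excPlaces_betaInsert hr hx, excPlaces_eq_union, inv_union, inv_union,
    hw.inv_insert_setA_betaInsert hx, hw.inv_high_betaInsert hr hx,
    Finset.sum_image fun i _ j _ h => add_left_injective 1 h,
    Finset.sum_congr rfl fun j hj => hw.card_cross_betaInsert hr hx hj]
  · omega
  · intro i hi j hj
    rw [mem_setA] at hi
    rw [mem_highPlaces] at hj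
    omega
  · exact hw.injOn (Finset.filter_subset _ _)
  · intro i hi j hj
    obtain ⟨k, hk, rfl⟩ := Finset.mem_image.1 hj
    have := hb i hi
    rw [mem_highPlaces] at hk
    omega
  · exact (hw.betaInsert hr hx).injOn fun i hi =>
      Finset.mem_Icc.2 ⟨(hb i hi).1, (hb i hi).2.1⟩

theorem IsWord.inv_nonexc_betaInsert (hw : IsWord m w) (hr : r ≤ m) (hx : x ∈ setB r m w) :
    inv (nonexcPlaces r (m + 1) (RDenert.betaInsert r m x w)) (RDenert.betaInsert r m x w) =
      inv (nonexcPlaces r m w) w := by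
  have h := hw.excTransfer_betaInsert hr hx
  have hn : ∀ i ∈ nonexcPlaces r (m + 1) (RDenert.betaInsert r m x w),
      i ∉ insert x (setA r m w) ∧ (i ∈ setB r m w ∨ r ≤ i) := by
    intro i hi
    rw [mem_nonexcPlaces, hw.excPlaces_betaInsert hr hx, Finset.mem_union, not_or] at hi
    refine ⟨hi.2.1, ?_⟩
    by_contra hc
    push Not at hc
    have h1 := hi.2.1
    rw [Finset.mem_insert, mem_setA] at h1
    rw [mem_setB] at hc
    omega
  have hnot : x ∉ nonexcPlaces r (m + 1) (RDenert.betaInsert r m x w) := fun h' =>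
    (hn x h').1 (Finset.mem_insert_self _ _)
  rw [← Finset.erase_eq_of_notMem hnot]
  refine h.inv_nonexc (fun i hi j hj hix hjx hij => pushPlace_lt_pushPlace hx setB_bounds
    (hn i hi).2 (hn j hj).2 hix hjx hij) fun i hi hix => ?_
  have a := (mem_nonexcPlaces.1 hi).1
  have a' := h.maps a.1 a.2 hix
  rw [hw.betaInsert_of_notMem hr hx a.1 a.2 (hn i hi).1, betaPush_of_ne hix, up_of_not]
  rw [h.nonexc_iff i a.1 a.2 hix, mem_nonexcPlaces] at hi
  exact fun h' => hi.2 ((hw.mem_excLetters a'.1 a'.2).1 h'.1)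

theorem IsWord.den_betaInsert (hw : IsWord m w) (hr : r ≤ m) (hx : x ∈ setB r m w) :
    den r (m + 1) (RDenert.betaInsert r m x w) =
      den r m w + (x + exc r m w + ((setA r m w).filter fun j => x < j).card) := by
  have e1 := hw.inv_exc_betaInsert hr hx
  have e2 := hw.inv_nonexc_betaInsert hr hx
  have e3 : ∑ i ∈ excPlaces r (m + 1) (RDenert.betaInsert r m x w), i =
      ∑ i ∈ excPlaces r m w, i + (x + exc r m w) := by
    rw [sum_excPlaces, hw.setA_betaInsert hr hx, hw.highPlaces_betaInsert hr hx,
      Finset.sum_insert (notMem_setA_of_setB hx), sum_image_succ, sum_excPlaces, exc_eq_card]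
    omega
  unfold den
  omega

end Beta

/-! ### Recovering a word from its insertion -/

section Congr
variable {r m : ℕ} {u w : ℕ → ℕ}

theorem excPlaces_congr (h : ∀ i, 1 ≤ i → i ≤ m → u i = w i) :
    excPlaces r m u = excPlaces r m w :=
  Finset.filter_congr fun i hi => by
    rw [Finset.mem_Icc] at hi
    rw [h i hi.1 hi.2]

theorem excLetters_congr (h : ∀ i, 1 ≤ i → i ≤ m → u i = w i) :
    excLetters r m u = excLetters r m w := by
  rw [excLetters, excLetters, excPlaces_congr h]
  apply Finset.image_congr
  intro i hi
  have := (mem_excPlaces.1 hi).1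
  exact h i this.1 this.2

theorem setA_congr (h : ∀ i, 1 ≤ i → i ≤ m → u i = w i) : setA r m u = setA r m w :=
  Finset.filter_congr fun i hi => by
    rw [Finset.mem_Icc] at hi
    rw [h i hi.1 hi.2]

theorem setB_eq_of_setA_eq (h : setA r m u = setA r m w) :
    setB r m u = setB r m w := by
  ext i
  have := Finset.ext_iff.1 h i
  rw [mem_setA, mem_setA] at this
  rw [mem_setB, mem_setB]
  omega

end Congr

/-- The letter at the place `i ≥ r` is at least `i`, and there is no excedance letter between. -/
def IsTight (r n : ℕ) (τ : ℕ → ℕ) (i : ℕ) : Prop :=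
  r ≤ i ∧ i ≤ n ∧ i ≤ τ i ∧ ∀ e ∈ excLetters r n τ, i ≤ e → τ i ≤ e

section Tight
variable {r m x a : ℕ} {w τ : ℕ → ℕ}

theorem IsTight.congr {n i : ℕ} {τ' : ℕ → ℕ} (hr : 1 ≤ r) (h : ∀ i, 1 ≤ i → i ≤ n → τ i = τ' i)
    (hi : IsTight r n τ i) : IsTight r n τ' i := by
  have h1 := h i (hr.trans hi.1) hi.2.1
  refine ⟨hi.1, hi.2.1, h1 ▸ hi.2.2.1, ?_⟩
  rw [← excLetters_congr h, ← h1]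
  exact hi.2.2.2

/-- If `j` was an excedance place, its old letter is still an excedance letter of `τ` and lies in
the gap between `j + 1` and the raised letter. Otherwise the letter is too small for place `j + 1`.
-/
theorem IsWord.not_isTight_succ (hw : IsWord m w) {j : ℕ} (h1 : 1 ≤ j) (hj : j ≤ m)
    (ha : a ≤ j + 1) (hτ : τ (j + 1) = up (excLetters r m w) (m + 1) a (w j))
    (hE : ∀ e ∈ excLetters r m w, j + 1 ≤ e → e ∈ excLetters r (m + 1) τ) :
    ¬ IsTight r (m + 1) τ (j + 1) := by
  rintro ⟨h2, h3, h4, h5⟩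
  have hmem := hw.mem_excLetters (r := r) h1 hj
  by_cases h : j ∈ excPlaces r m w
  · have h6 := mem_excPlaces.1 h
    have h7 := h5 _ (hE _ (hmem.2 h) (by omega)) (by omega)
    have h8 := lt_up (hmem.2 h) (a := a) (by omega) (hw.le h1 hj)
    omega
  · rw [hτ, up_of_not fun h' => h (hmem.1 h'.1)] at h4
    rw [mem_excPlaces] at h
    omega

theorem IsWord.last_notMem (hw : IsWord m w) : m + 1 ∉ excLetters r m w := fun h => by
  have := hw.excLetters_bounds h
  omega

theorem IsWord.insert_least_image (hw : IsWord m w) :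
    insert (least (excLetters r m w) (m + 1) a)
      ((excLetters r m w).image (up (excLetters r m w) (m + 1) a)) =
      insert (m + 1) (excLetters r m w) :=
  insert_least_image_up fun _ he => (hw.excLetters_bounds he).2.2

theorem insert_last_inj {E E' : Finset ℕ} {n : ℕ} (hE : n ∉ E) (hE' : n ∉ E')
    (h : insert n E = insert n E') : E = E' := by
  rw [← Finset.erase_insert hE, h, Finset.erase_insert hE']

/-! #### Han's insertion -/

theorem IsWord.excLetters_hanInsert (hw : IsWord m w) (h1 : 1 ≤ x) (hx : x ≤ m + 1) :
    insert (RDenert.hanInsert r m x w x) (excLetters r (m + 1) (RDenert.hanInsert r m x w)) =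
      insert (m + 1) (excLetters r m w) := by
  rw [(hw.excTransfer_hanInsert h1 hx).insert_excLetters fun i _ hix => hanInsert_of_ne hix,
    hanInsert_self, hw.insert_least_image]

theorem IsWord.isTight_hanInsert (hw : IsWord m w) (hr : 1 ≤ r) (h1 : r ≤ x) (hx : x ≤ m + 1) :
    IsTight r (m + 1) (RDenert.hanInsert r m x w) x := by
  refine ⟨h1, hx, by rw [hanInsert_self]; exact le_least hx, fun e he hxe => ?_⟩
  have h2 := Finset.mem_insert_of_mem (a := e) (b := RDenert.hanInsert r m x w x) he
  rw [hw.excLetters_hanInsert (hr.trans h1) hx, Finset.mem_insert] at h2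
  rw [hanInsert_self]
  rcases h2 with rfl | h2
  · exact least_le_right
  · exact least_le h2 hxe

/-- With `isTight_hanInsert` this recovers `x` from the output, as its largest tight place. -/
theorem IsWord.le_of_isTight_hanInsert (hw : IsWord m w) (hr : 1 ≤ r) (h1 : r ≤ x)
    (hx : x ≤ m + 1) {i : ℕ} (hi : IsTight r (m + 1) (RDenert.hanInsert r m x w) i) : i ≤ x := by
  by_contra! hlt
  obtain ⟨j, rfl⟩ : ∃ j, i = j + 1 := ⟨i - 1, by omega⟩
  have him := hi.2.1
  refine hw.not_isTight_succ (a := x) (by omega) (by omega) hlt.le ?_ ?_ hi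
  · rw [hanInsert_of_ne hlt.ne', shift_of_gt hlt, Nat.add_sub_cancel]
  · intro e he hje
    have h2 := Finset.mem_insert_of_mem (a := e) (b := m + 1) he
    rw [← hw.excLetters_hanInsert (hr.trans h1) hx, Finset.mem_insert] at h2
    rcases h2 with rfl | h2
    -- If `e` is the inserted letter, then `e ≥ j + 1 > x` shows that `x` is an excedance place.
    · refine Finset.mem_image_of_mem _ (mem_excPlaces.2 ⟨⟨hr.trans h1, hx⟩, by omega, by omega⟩)
    · exact h2

/-! #### Insertion at a place of `𝒜` -/

theorem IsWord.excLetters_alphaInsert (hw : IsWord m w) (hr : r ≤ m) (hx : x ∈ setA r m w) :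
    excLetters r (m + 1) (RDenert.alphaInsert r m x w) = insert (m + 1) (excLetters r m w) := by
  have h1 : RDenert.alphaInsert r m x w x ∈ excLetters r (m + 1) (RDenert.alphaInsert r m x w) :=
    Finset.mem_image_of_mem _ ((hw.mem_exc_alphaInsert hr hx x).2 (Or.inl hx))
  rw [← Finset.insert_eq_of_mem h1,
    (hw.excTransfer_alphaInsert hr hx).insert_excLetters fun i _ hix => alphaInsert_of_ne hix,
    alphaInsert_self, hw.insert_least_image]

/-- Beyond `r` every letter is shifted by one. At `r` stands a raised letter of `𝒜`, whose old value
is `≥ r` and is still an excedance letter, so it fills the gap. -/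
theorem IsWord.not_isTight_alphaInsert (hw : IsWord m w) (hr : r ≤ m) (hx : x ∈ setA r m w)
    (i : ℕ) : ¬ IsTight r (m + 1) (RDenert.alphaInsert r m x w) i := by
  intro hi
  have hxr := setA_bounds x hx
  rcases hi.1.eq_or_lt with rfl | hlt
  · have h1 := (pushPlace_mem hx setA_bounds (Or.inr rfl) hxr.2.ne').1
    have h2 := (mem_setA.1 h1).2.1
    have h3 : w (pushPlace (setA r m w) r x r) ∈ excLetters r m w :=
      Finset.mem_image_of_mem _ (setA_subset_excPlaces h1)
    have h4 := hi.2.2.2 (w (pushPlace (setA r m w) r x r)) (by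
      rw [hw.excLetters_alphaInsert hr hx]; exact Finset.mem_insert_of_mem h3) h2
    rw [alphaInsert_of_ne hxr.2.ne'] at h4
    have h5 := lt_up (a := 0) h3 (Nat.zero_le _) (hw.excLetters_bounds h3).2.2
    omega
  · obtain ⟨j, rfl⟩ : ∃ j, i = j + 1 := ⟨i - 1, by omega⟩
    have him := hi.2.1
    refine hw.not_isTight_succ (a := 0) (by omega) (by omega) (by omega) ?_ ?_ hi
    · rw [alphaInsert_of_ne (by omega), pushPlace_of_gt hlt, Nat.add_sub_cancel]
    · intro e he _
      rw [hw.excLetters_alphaInsert hr hx]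
      exact Finset.mem_insert_of_mem he

theorem IsWord.le_alphaInsert (hw : IsWord m w) (hr : r ≤ m) (hx : x ∈ setA r m w) :
    r ≤ RDenert.alphaInsert r m x w r :=
  (mem_excPlaces.1 ((hw.mem_exc_alphaInsert hr hx r).2 (Or.inr (Or.inl rfl)))).2.2

/-! #### Insertion at a place of `ℬ` -/

theorem IsWord.excLetters_betaInsert (hw : IsWord m w) (hr : r ≤ m) (hx : x ∈ setB r m w) :
    excLetters r (m + 1) (RDenert.betaInsert r m x w) = insert (m + 1) (excLetters r m w) := by
  have hP : excPlaces r (m + 1) (RDenert.betaPush r m x w) =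
      insert x (setA r m w) ∪ (highPlaces r m w).image (· + 1) := by
    ext i
    rw [hw.mem_exc_betaPush hr hx, Finset.mem_union]
  have h1 : RDenert.betaPush r m x w x ∈ excLetters r (m + 1) (RDenert.betaPush r m x w) := by
    refine Finset.mem_image_of_mem _ ?_
    rw [hP]
    exact Finset.mem_union_left _ (Finset.mem_insert_self _ _)
  have h2 : excLetters r (m + 1) (RDenert.betaInsert r m x w) =
      (excLetters r (m + 1) (RDenert.betaPush r m x w)).image (rot (rotLetters r m x w)) := by
    rw [excLetters, excLetters, Finset.image_image, hw.excPlaces_betaInsert hr hx, hP]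
    rfl
  rw [h2, image_rot_of_subset, ← Finset.insert_eq_of_mem h1,
    (hw.excTransfer_betaPush hr hx).insert_excLetters fun i _ hix => betaPush_of_ne hix,
    betaPush_self, hw.insert_least_image]
  rw [excLetters, hP]
  exact Finset.image_subset_image Finset.subset_union_left

theorem IsWord.betaInsert_lt (hw : IsWord m w) (hr : 1 ≤ r) (hrm : r ≤ m) (hx : x ∈ setB r m w) :
    RDenert.betaInsert r m x w r < r := by
  have hxr := setB_bounds x hx
  have h1 := mem_setB.1 (pushPlace_mem hx setB_bounds (Or.inr rfl) hxr.2.ne').1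
  rw [hw.betaInsert_of_notMem hrm hx hr (by omega), betaPush_of_ne hxr.2.ne', up_of_not]
  · exact h1.2.1
  · intro h
    have := hw.excLetters_bounds h.1
    omega
  · intro h
    have := insert_setA_bounds hx r h
    omega

/-- At `r` stands a letter of `ℬ`, which is below `r`; beyond `r` every letter is shifted by one. -/
theorem IsWord.not_isTight_betaInsert (hw : IsWord m w) (hr : 1 ≤ r) (hrm : r ≤ m)
    (hx : x ∈ setB r m w) (i : ℕ) : ¬ IsTight r (m + 1) (RDenert.betaInsert r m x w) i := by
  intro hi
  have hxr := setB_bounds x hx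
  rcases hi.1.eq_or_lt with rfl | hlt
  · have := hw.betaInsert_lt hr hrm hx
    have := hi.2.2.1
    omega
  · obtain ⟨j, rfl⟩ : ∃ j, i = j + 1 := ⟨i - 1, by omega⟩
    have him := hi.2.1
    refine hw.not_isTight_succ (a := 0) (by omega) (by omega) (by omega) ?_ ?_ hi
    · rw [hw.betaInsert_of_notMem hrm hx (by omega) (by omega), betaPush_of_ne (by omega),
        pushPlace_of_gt hlt, Nat.add_sub_cancel]
      intro h
      have := insert_setA_bounds hx _ h
      omega
    · intro e he _
      rw [hw.excLetters_betaInsert hrm hx]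
      exact Finset.mem_insert_of_mem he

end Tight

/-! ### The glued insertion -/

/-- The insertion at the space `x`. -/
def glue (r m x : ℕ) (w : ℕ → ℕ) : ℕ → ℕ :=
  if x ∈ setA r m w then alphaInsert r m x w
  else if x ∈ setB r m w then betaInsert r m x w
  else hanInsert r m x w

section Glue
variable {r m x y : ℕ} {u w : ℕ → ℕ}

/-- The three kinds of spaces. -/
theorem glue_cases (hr : r ≤ m) (h1 : 1 ≤ x) (w : ℕ → ℕ) :
    (x ∈ setA r m w ∧ glue r m x w = alphaInsert r m x w) ∨
    (x ∈ setB r m w ∧ glue r m x w = betaInsert r m x w) ∨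
    (r ≤ x ∧ glue r m x w = hanInsert r m x w) := by
  by_cases hA : x ∈ setA r m w
  · exact Or.inl ⟨hA, if_pos hA⟩
  by_cases hB : x ∈ setB r m w
  · exact Or.inr (Or.inl ⟨hB, by rw [glue, if_neg hA, if_pos hB]⟩)
  · refine Or.inr (Or.inr ⟨?_, by rw [glue, if_neg hA, if_neg hB]⟩)
    rw [mem_setA] at hA
    rw [mem_setB] at hB
    omega

theorem IsWord.glue (hw : IsWord m w) (hr : r ≤ m) (h1 : 1 ≤ x) (hx : x ≤ m + 1) :
    IsWord (m + 1) (glue r m x w) := by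
  rcases glue_cases hr h1 w with ⟨h, e⟩ | ⟨h, e⟩ | ⟨h, e⟩ <;> rw [e]
  · exact hw.alphaInsert hr h
  · exact hw.betaInsert hr h
  · exact hw.hanInsert h1 hx

theorem hanInsert_inj (hw : IsWord m w) (hu : IsWord m u) (hr : 1 ≤ r)
    (hx : r ≤ x) (hxm : x ≤ m + 1) (hy : r ≤ y) (hym : y ≤ m + 1)
    (h : ∀ i, 1 ≤ i → i ≤ m + 1 → hanInsert r m x w i = hanInsert r m y u i) :
    x = y ∧ ∀ i, 1 ≤ i → i ≤ m → w i = u i := by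
  have hx1 := hr.trans hx
  have hxy : x = y := le_antisymm
    (hu.le_of_isTight_hanInsert hr hy hym ((hw.isTight_hanInsert hr hx hxm).congr hr h))
    (hw.le_of_isTight_hanInsert hr hx hxm ((hu.isTight_hanInsert hr hy hym).congr hr
      fun i h1 h2 => (h i h1 h2).symm))
  subst hxy
  have hE : excLetters r m w = excLetters r m u := by
    apply insert_last_inj hw.last_notMem hu.last_notMem
    rw [← hw.excLetters_hanInsert hx1 hxm, ← hu.excLetters_hanInsert hx1 hxm,
      excLetters_congr h, h x hx1 hxm]
  refine ⟨rfl, fun i h1 h2 => ?_⟩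
  unfold hanInsert at h
  rw [← hE] at h
  exact (placeMap_shift hx1 hxm).cancel hw hu (fun _ _ _ hk _ hl => up_inj hk hl) h h1 h2

/-- The output shows `E` as its excedance letters without `m + 1`, and shows `𝒜` unchanged; `x` is
the place of the smallest element of `E ∪ {m + 1}`. -/
theorem alphaInsert_inj (hw : IsWord m w) (hu : IsWord m u) (hrm : r ≤ m)
    (hx : x ∈ setA r m w) (hy : y ∈ setA r m u)
    (h : ∀ i, 1 ≤ i → i ≤ m + 1 → alphaInsert r m x w i = alphaInsert r m y u i) :
    x = y ∧ ∀ i, 1 ≤ i → i ≤ m → w i = u i := by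
  have hE : excLetters r m w = excLetters r m u := by
    apply insert_last_inj hw.last_notMem hu.last_notMem
    rw [← hw.excLetters_alphaInsert hrm hx, ← hu.excLetters_alphaInsert hrm hy,
      excLetters_congr h]
  have hA : setA r m w = setA r m u := by
    rw [← hw.setA_alphaInsert hrm hx, ← hu.setA_alphaInsert hrm hy, setA_congr h]
  have hxb := setA_bounds x hx
  have hyb := setA_bounds y hy
  have hxy : x = y := by
    apply (hw.alphaInsert hrm hx).inj hxb.1 (by omega) hyb.1 (by omega)
    rw [h y hyb.1 (by omega), alphaInsert_self, alphaInsert_self, hE]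
  subst hxy
  refine ⟨rfl, fun i h1 h2 => ?_⟩
  unfold alphaInsert at h
  rw [← hE, ← hA] at h
  exact (placeMap_pushPlace hx setA_bounds hrm).cancel hw hu (fun _ _ _ hk _ hl => up_inj hk hl)
    h h1 h2

/-- The output shows `E` and `𝒜 ∪ {x}`. The rotated letters are those at these places, and `x`
carries the largest of them. This gives `𝒜`, hence `ℬ` as its complement below `r`; the rotation can
then be undone. -/
theorem betaInsert_inj (hw : IsWord m w) (hu : IsWord m u) (hrm : r ≤ m)
    (hx : x ∈ setB r m w) (hy : y ∈ setB r m u)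
    (h : ∀ i, 1 ≤ i → i ≤ m + 1 → betaInsert r m x w i = betaInsert r m y u i) :
    x = y ∧ ∀ i, 1 ≤ i → i ≤ m → w i = u i := by
  have hE : excLetters r m w = excLetters r m u := by
    apply insert_last_inj hw.last_notMem hu.last_notMem
    rw [← hw.excLetters_betaInsert hrm hx, ← hu.excLetters_betaInsert hrm hy,
      excLetters_congr h]
  have hA : insert x (setA r m w) = insert y (setA r m u) := by
    rw [← hw.setA_betaInsert hrm hx, ← hu.setA_betaInsert hrm hy, setA_congr h]
  have hF : rotLetters r m x w = rotLetters r m y u := by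
    rw [← image_betaInsert, ← image_betaInsert, ← hA]
    apply Finset.image_congr
    intro i hi
    have := insert_setA_bounds hx i hi
    exact h i this.1 this.2.1
  have hxb := setB_bounds x hx
  have hyb := setB_bounds y hy
  have hxy : x = y := by
    apply (hw.betaInsert hrm hx).inj hxb.1 (by omega) hyb.1 (by omega)
    rw [h y hyb.1 (by omega), hw.betaInsert_self hx, hu.betaInsert_self hy, hF]
  subst hxy
  have hB : setB r m w = setB r m u := setB_eq_of_setA_eq
    (insert_last_inj (notMem_setA_of_setB hx) (notMem_setA_of_setB hy) hA)
  refine ⟨rfl, fun i h1 h2 => ?_⟩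
  have h' : ∀ i, 1 ≤ i → i ≤ m + 1 → betaPush r m x w i = betaPush r m x u i := by
    intro i h1 h2
    have := h i h1 h2
    rw [betaInsert, betaInsert, hF] at this
    exact rot_inj this
  unfold betaPush at h'
  rw [← hE, ← hB] at h'
  exact (placeMap_pushPlace hx setB_bounds hrm).cancel hw hu (fun _ _ _ hk _ hl => up_inj hk hl)
    h' h1 h2

theorem glue_inj (hw : IsWord m w) (hu : IsWord m u) (hr : 1 ≤ r) (hrm : r ≤ m)
    (hx : 1 ≤ x) (hxm : x ≤ m + 1) (hy : 1 ≤ y) (hym : y ≤ m + 1)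
    (h : ∀ i, 1 ≤ i → i ≤ m + 1 → glue r m x w i = glue r m y u i) :
    x = y ∧ ∀ i, 1 ≤ i → i ≤ m → w i = u i := by
  have h' : ∀ i, 1 ≤ i → i ≤ m + 1 → glue r m y u i = glue r m x w i :=
    fun i h1 h2 => (h i h1 h2).symm
  -- The letter at place `r` is `≥ r` after `α` and `< r` after `β`.
  have hlast := h r hr (by omega)
  rcases glue_cases hrm hx w with ⟨a, e⟩ | ⟨a, e⟩ | ⟨a, e⟩ <;>
  rcases glue_cases hrm hy u with ⟨b, f⟩ | ⟨b, f⟩ | ⟨b, f⟩ <;>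
  rw [e, f] at h h' hlast
  · exact alphaInsert_inj hw hu hrm a b h
  · have := hw.le_alphaInsert hrm a
    have := hu.betaInsert_lt hr hrm b
    omega
  · exact absurd ((hu.isTight_hanInsert hr b hym).congr hr h') (hw.not_isTight_alphaInsert hrm a _)
  · have := hu.le_alphaInsert hrm b
    have := hw.betaInsert_lt hr hrm a
    omega
  · exact betaInsert_inj hw hu hrm a b h
  · exact absurd ((hu.isTight_hanInsert hr b hym).congr hr h')
      (hw.not_isTight_betaInsert hr hrm a _)
  · exact absurd ((hw.isTight_hanInsert hr a hxm).congr hr h) (hu.not_isTight_alphaInsert hrm b _)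
  · exact absurd ((hw.isTight_hanInsert hr a hxm).congr hr h)
      (hu.not_isTight_betaInsert hr hrm b _)
  · exact hanInsert_inj hw hu hr a hxm b hym h

theorem least_eq_self_iff {E : Finset ℕ} {n : ℕ} (hx : x ≤ n) :
    x = least E n x ↔ x = n ∨ x ∈ E := by
  constructor
  · intro h
    rcases least_mem E n x with h' | h'
    · exact Or.inl (h.trans h')
    · exact Or.inr (h ▸ h'.1)
  · rintro (rfl | h)
    · exact le_antisymm (le_least le_rfl) least_le_right
    · exact le_antisymm (le_least hx) (least_le h le_rfl)

theorem IsWord.den_glue (hw : IsWord m w) (hr : 1 ≤ r) (hrm : r ≤ m) (h1 : 1 ≤ x)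
    (hx : x ≤ m + 1) : den r (m + 1) (RDenert.glue r m x w) = den r m w + label r m w x := by
  rcases glue_cases hrm h1 w with ⟨h, e⟩ | ⟨h, e⟩ | ⟨h, e⟩ <;> rw [e]
  · rw [hw.den_alphaInsert hrm h, hw.label_setA_eq hr h]
  · rw [hw.den_betaInsert hrm h, hw.label_setB_eq (by omega) h]
  · by_cases hxv : x = least (excLetters r m w) (m + 1) x
    · rw [hw.den_hanInsert_of_fixed hr h hx hxv]
      rcases (least_eq_self_iff hx).1 hxv with rfl | hE
      · rw [label_last, Finset.filter_false_of_mem, Finset.card_empty]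
        intro e he
        have := hw.excLetters_bounds he
        omega
      · rw [hw.label_excLetters hE]
    · rw [hw.den_hanInsert_of_exc hr h hx hxv]
      rw [least_eq_self_iff hx, not_or] at hxv
      rw [hw.label_of_ge hr h (by omega) hxv.2]

/-- The excedance places `≥ r` gain one exactly for `𝒜` and for the spaces `x ≥ r` with `x` neither
in `E` nor equal to `m + 1`; these are the spaces labeled last, from `exc + r` on. -/
theorem IsWord.exc_glue (hw : IsWord m w) (hr : 1 ≤ r) (hrm : r ≤ m) (h1 : 1 ≤ x)
    (hx : x ≤ m + 1) : exc r (m + 1) (RDenert.glue r m x w) =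
      if label r m w x ≤ exc r m w + r - 1 then exc r m w else exc r m w + 1 := by
  have hl := hw.label_cases hr (by omega) h1 hx
  have hc := hw.card_excLetters_add hr (show r ≤ m + 1 by omega)
  rcases glue_cases hrm h1 w with ⟨h, e⟩ | ⟨h, e⟩ | ⟨h, e⟩ <;> rw [e]
  · rw [hw.exc_alphaInsert hrm h, hw.label_setA_eq hr h, if_neg (by omega)]
  · have h2 := mem_setB.1 h
    rw [hw.exc_betaInsert hrm h, if_pos]
    rcases hl with hl | hl | hl | hl
    · omega
    · omega
    · exact hl.2.2
    · exact absurd (Finset.mem_union_right _ h) (Finset.mem_sdiff.1 hl.1).2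
  · rw [hw.exc_hanInsert hr h hx]
    simp only [least_eq_self_iff hx]
    rcases hl with hl | hl | hl | hl
    · rw [if_pos (Or.inl hl.1), if_pos (by omega), add_zero]
    · rw [if_pos (Or.inr hl.1), if_pos (by omega), add_zero]
    · have := mem_setB.1 hl.1
      omega
    · have h3 := Finset.mem_sdiff.1 hl.1
      rw [Finset.mem_Icc, Finset.mem_union, not_or] at h3
      rw [if_neg (by rw [not_or]; exact ⟨by omega, h3.2.1⟩), if_neg (by omega)]

/-! ### The maps on one-line notations -/

theorem alpha_label (hw : IsWord m w) (hr : 1 ≤ r) (hrm : r ≤ m) (hx : x ∈ setA r m w) :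
    alpha r m w (label r m w x) = alphaInsert r m x w := by
  have hb := setA_bounds x hx
  rw [alpha, hw.space_label hr (by omega) hb.1 (by omega)]
  exact push_eq_insertLetter hx setA_bounds _ _ _

theorem beta_label (hw : IsWord m w) (hr : 1 ≤ r) (hrm : r ≤ m) (hx : x ∈ setB r m w) :
    beta r m w (label r m w x) = betaInsert r m x w := by
  have hb := setB_bounds x hx
  have h : push (setB r m w) r x (least (excLetters r m w) (m + 1) 0)
      (raise (excLetters r m w) (m + 1) 0 w) = betaPush r m x w :=
    push_eq_insertLetter hx setB_bounds _ _ _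
  rw [beta, hw.space_label hr (by omega) hb.1 (by omega)]
  simp only [h]
  rw [hw.filter_exc_betaPush hrm hx]
  rfl

theorem least_excLetters_one (hr : 1 ≤ r) {a : ℕ} (ha : r ≤ a) (n : ℕ) :
    least (excLetters 1 m w) n a = least (excLetters r m w) n a := by
  have : (excLetters 1 m w).filter (fun e => a ≤ e) =
      (excLetters r m w).filter fun e => a ≤ e := by
    rw [excLetters_eq_filter hr, Finset.filter_filter]
    exact Finset.filter_congr fun e _ => by omega
  unfold least
  simp only [this]

theorem up_excLetters_one (hr : 1 ≤ r) {a : ℕ} (ha : r ≤ a) (n l : ℕ) :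
    up (excLetters 1 m w) n a l = up (excLetters r m w) n a l := by
  have h : l ∈ excLetters 1 m w ∧ a ≤ l ↔ l ∈ excLetters r m w ∧ a ≤ l := by
    rw [excLetters_eq_filter hr, Finset.mem_filter]
    constructor
    · exact fun h => ⟨⟨h.1, ha.trans h.2⟩, h.2⟩
    · exact fun h => ⟨h.1.1, h.2⟩
  by_cases h' : l ∈ excLetters r m w ∧ a ≤ l
  · rw [up_of h'.1 h'.2, up_of (h.2 h').1 h'.2, least_excLetters_one hr (by omega)]
  · rw [up_of_not h', up_of_not fun h2 => h' (h.1 h2)]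

/-- For `x ≥ r` only excedance letters `≥ x` matter, so Han's map with its level `1` data coincides
with the insertion using level `r` data. -/
theorem han_label (hw : IsWord m w) (hr : 1 ≤ r) (hx : r ≤ x) (hxm : x ≤ m + 1) :
    han m w (label r m w x) = hanInsert r m x w := by
  funext i
  rw [han, ← hw.label_one hr hx hxm, hw.space_label le_rfl (by omega) (by omega) hxm]
  simp only [insertBefore, raise_eq, up_least_eq hxm]
  simp only [up_excLetters_one hr hx, least_excLetters_one hr hx]
  rcases lt_trichotomy i x with h | rfl | h
  · rw [if_pos h, hanInsert_of_ne h.ne, shift_of_lt h]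
  · rw [if_neg (lt_irrefl _), if_pos rfl, hanInsert_self]
  · rw [if_neg h.asymm, if_neg h.ne', hanInsert_of_ne h.ne', shift_of_gt h]

theorem phiDen_label (hw : IsWord m w) (hr : 1 ≤ r) (hrm : r ≤ m) (h1 : 1 ≤ x)
    (hx : x ≤ m + 1) : phiDen r m w (label r m w x) = glue r m x w := by
  rw [phiDen, hw.space_label hr (by omega) h1 hx, glue]
  split_ifs with hA hB
  · exact alpha_label hw hr hrm hA
  · exact beta_label hw hr hrm hB
  · refine han_label hw hr ?_ hx
    rw [mem_setA] at hA
    rw [mem_setB] at hB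
    omega

end Glue

/-! ### Transfer to permutations -/

theorem exists_bijective_phiDen {m r : ℕ} (hr : 1 ≤ r) (hrm : r ≤ m) :
    ∃ φ : Equiv.Perm (Fin m) × Fin (m + 1) → Equiv.Perm (Fin (m + 1)),
      Function.Bijective φ ∧
      ∀ (π : Equiv.Perm (Fin m)) (c : Fin (m + 1)),
        exc r (m + 1) (letters (φ (π, c))) =
          (if (c : ℕ) ≤ exc r m (letters π) + r - 1 then exc r m (letters π)
            else exc r m (letters π) + 1) ∧
        den r (m + 1) (letters (φ (π, c))) = den r m (letters π) + (c : ℕ) ∧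
        ∀ i ∈ Finset.Icc 1 (m + 1), letters (φ (π, c)) i = phiDen r m (letters π) (c : ℕ) i := by
  have key : ∀ p : Equiv.Perm (Fin m) × Fin (m + 1), ∃ ρ : Equiv.Perm (Fin (m + 1)),
      ∃ x, 1 ≤ x ∧ x ≤ m + 1 ∧ label r m (letters p.1) x = p.2 ∧
        ∀ i, 1 ≤ i → i ≤ m + 1 → letters ρ i = glue r m x (letters p.1) i := by
    intro p
    have hw := isWord_letters p.1
    obtain ⟨x, h1, h2, h3, -⟩ := hw.exists_label_eq hr (by omega) (Nat.lt_succ_iff.1 p.2.2)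
    obtain ⟨ρ, hρ⟩ := (hw.glue hrm h1 h2).exists_perm
    exact ⟨ρ, x, h1, h2, h3, hρ⟩
  choose φ x h1 h2 h3 h4 using key
  refine ⟨φ, ?_, fun π c => ?_⟩
  · rw [Fintype.bijective_iff_injective_and_card]
    constructor
    · rintro ⟨π, c⟩ ⟨ρ, d⟩ h
      have e := glue_inj (isWord_letters π) (isWord_letters ρ) hr hrm (h1 (π, c)) (h2 (π, c))
        (h1 (ρ, d)) (h2 (ρ, d)) fun i hi hi' => by
          rw [← h4 (π, c) i hi hi', ← h4 (ρ, d) i hi hi', h]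
      have hπ : π = ρ := letters_injective e.2
      subst hπ
      have hc : (c : ℕ) = d := by
        have a := h3 (π, c)
        have b := h3 (π, d)
        rw [e.1] at a
        exact a.symm.trans b
      rw [Fin.ext hc]
    -- Both sides have `(m + 1)!` elements, so injectivity is enough.
    · simp [Fintype.card_perm, Nat.factorial_succ, mul_comm]
  · have hw := isWord_letters π
    have a := h1 (π, c)
    have b := h2 (π, c)
    have h := h4 (π, c)
    have hc : label r m (letters π) (x (π, c)) = c := h3 (π, c)
    have hexc : exc r (m + 1) (letters (φ (π, c))) =
        exc r (m + 1) (glue r m (x (π, c)) (letters π)) := by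
      unfold exc
      congr 1
      refine Finset.filter_congr fun i hi => ?_
      rw [Finset.mem_Icc] at hi
      rw [h i hi.1 hi.2]
    have hden : den r (m + 1) (letters (φ (π, c))) =
        den r (m + 1) (glue r m (x (π, c)) (letters π)) := by
      have e1 := excPlaces_congr (r := r) h
      have hinv : ∀ P ⊆ Finset.Icc 1 (m + 1), inv P (letters (φ (π, c))) =
          inv P (glue r m (x (π, c)) (letters π)) := by
        intro P hP
        refine inv_congr (q := id) (fun i hi => hi) (fun i _ j _ h => h)
          (fun k hk => ⟨k, hk, rfl⟩) fun i hi j hj _ => ?_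
        have hi := Finset.mem_Icc.1 (hP hi)
        have hj := Finset.mem_Icc.1 (hP hj)
        rw [h i hi.1 hi.2, h j hj.1 hj.2]
        rfl
      rw [den, den, nonexcPlaces, nonexcPlaces, e1, hinv _ excPlaces_subset,
        hinv _ Finset.sdiff_subset]
    refine ⟨?_, ?_, fun i hi => ?_⟩
    · rw [hexc, hw.exc_glue hr hrm a b, hc]
    · rw [hden, hw.den_glue hr hrm a b, hc]
    · rw [Finset.mem_Icc] at hi
      rw [h i hi.1 hi.2, ← hc, phiDen_label hw hr hrm a b]

end RDenert

theorem theorem3p1 (n r : ℕ) (hr : 1 ≤ r) (hrn : r < n) :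
    (∀ π : Equiv.Perm (Fin (n - 1)), ∀ c : Fin n,
      ∃! x : ℕ, x ∈ Finset.Icc 1 n ∧ RDenert.label r (n - 1) (RDenert.letters π) x = (c : ℕ)) ∧
    ∃ φ : Equiv.Perm (Fin (n - 1)) × Fin n → Equiv.Perm (Fin n),
      Function.Bijective φ ∧
      ∀ (π : Equiv.Perm (Fin (n - 1))) (c : Fin n),
        RDenert.exc r n (RDenert.letters (φ (π, c))) =
          (if (c : ℕ) ≤ RDenert.exc r (n - 1) (RDenert.letters π) + r - 1
            then RDenert.exc r (n - 1) (RDenert.letters π)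
            else RDenert.exc r (n - 1) (RDenert.letters π) + 1) ∧
        RDenert.den r n (RDenert.letters (φ (π, c))) =
          RDenert.den r (n - 1) (RDenert.letters π) + (c : ℕ) ∧
        ∀ i ∈ Finset.Icc 1 n,
          RDenert.letters (φ (π, c)) i =
            RDenert.phiDen r (n - 1) (RDenert.letters π) (c : ℕ) i := by
  -- After the substitution `m + 1 - 1` reduces definitionally to `m`, so the results for length `m`
  -- apply as they are.
  obtain ⟨m, rfl⟩ : ∃ m, n = m + 1 := ⟨n - 1, by omega⟩
  exact ⟨fun π c => (RDenert.isWord_letters (m := m) π).existsUnique_label hr (by omega)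
    (Nat.lt_succ_iff.1 c.2), RDenert.exists_bijective_phiDen hr (Nat.lt_succ_iff.1 hrn)⟩
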